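/- Let $n\ge 1$. A weight on $\mathbb{R}^n$ is a non-negative, locally integrable function $w$; put $w(E)=\int_E w$. Let $$M_S f(x)=\sup_{R\ni x}\frac1{|R|}\int_R|f|,$$ where $R$ runs over the rectangles in $\mathbb{R}^n$ with sides parallel to the coordinate axes, and for $\alpha\in(0,1)$ let $$C_{S,w}(\alpha)=\sup_{E:\ 0<w(E)<\infty}\frac{w(\{x\in\mathbb{R}^n: M_S(\mathbf 1_E)(x)>\alpha\})}{w(E)},$$ the supremum being over measurable sets $E\subset\mathbb{R}^n$. For a non-negative function $v$ on $\mathbb{R}$ let $[v]_{A_\infty}=\sup_I \frac{1}{v(I)}\int_I M(v\mathbf 1_I)$, where $I$ runs over the bounded intervals of positive length, $M$ is the non-centred Hardy--Littlewood maximal operator on $\mathbb{R}$ and $0/0=0$. For a weight $w$ on $\mathbb{R}^n$ let $$[w]_{A_\infty^*}=\sup_{1\le j\le n}\ \operatorname*{ess\,sup}_{\bar x^j\in\mathbb{R}^{n-1}}\,[w_{\bar x^j}]_{A_\infty},$$ where $\bar x^j=(x_1,\dots,x_{j-1},x_{j+1},\dots,x_n)$ and $w_{\bar x^j}(t)=w(x_1,\dots,x_{j-1},t,x_{j+1},\dots,x_n)$;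 we say that $w$ is a strong Muckenhoupt weight, $w\in A_\infty^*$, if $[w]_{A_\infty^*}<\infty$. **Theorem.** (i) There are a numerical constant $c>0$ and, for every $n\ge1$, a constant $K_n>0$ depending only on $n$ such that for every $w\in A_\infty^*$ on $\mathbb{R}^n$ $$C_{S,w}(\alpha)-1\le K_n(1-\alpha)^{1/(cn[w]_{A_\infty^*})}\qquad\text{for all } 1>\alpha>1-e^{-cn[w]_{A_\infty^*}} .$$ (If $w=0$ a.e., the supremum defining $C_{S,w}$ is read as $0$ and the claim is trivial.) (ii) This is sharp in the following sense: there is a numerical constant $c'>0$ such that, for every $n\ge1$ and every weight $w$ on $\mathbb{R}^n$, if there are $B,\beta>1$ and $\gamma>0$ with $C_{S,w}(\alpha)-1\le B(1-\alpha)^{1/\beta}$ for all $1>\alpha>1-e^{-\gamma}$, then $w\in A_\infty^*$ and $$[w]_{A_\infty^*}\le c'\,\beta\,\bigl(1+\max(\gamma/\beta,\ln B)\bigr).$$ (iii) Hence a weight $w$ on $\mathbb{R}^n$ belongs to $A_\infty^*$ if and only if there are $B,\beta>1$ and $\gamma>0$ such that $C_{S,w}(\alpha)-1\le B(1-\alpha)^{1/\beta}$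 for all $1>\alpha>1-e^{-\gamma}$. -/

import Mathlib

open MeasureTheory Set
open scoped ENNReal

namespace Solyanik

noncomputable section

/-- A weight on Euclidean space: a non-negative, locally integrable function. -/
structure IsWeight {n : ℕ} (w : (Fin n → ℝ) → ℝ) : Prop where
  nonneg : ∀ x, 0 ≤ w x
  locallyIntegrable : LocallyIntegrable w volume

/-- The open rectangle with sides parallel to the axes and corners `a`, `b`. -/
def rect {n : ℕ} (a b : Fin n → ℝ) : Set (Fin n → ℝ) :=
  Set.univ.pi fun i => Ioo (a i) (b i)

/-- The (non-centred) strong maximal function of a non-negative function: the supremum of its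
Lebesgue averages over the axis-parallel rectangles that contain `x`. (Open rectangles give the
same supremum as closed or half-open ones.) -/
def strongMaximal {n : ℕ} (f : (Fin n → ℝ) → ℝ≥0∞) (x : Fin n → ℝ) : ℝ≥0∞ :=
  ⨆ (a : Fin n → ℝ) (b : Fin n → ℝ) (_ : x ∈ rect a b),
    (∫⁻ y in rect a b, f y) / volume (rect a b)

/-- The non-centred Hardy-Littlewood maximal function on the line of a non-negative function. -/
def hlMaximal (f : ℝ → ℝ≥0∞) (t : ℝ) : ℝ≥0∞ :=
  ⨆ (a : ℝ) (b : ℝ) (_ : t ∈ Ioo a b), (∫⁻ u in Ioo a b, f u) / volume (Ioo a b)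

/-- The Fujii-Wilson constant of `v : ℝ → ℝ`: the supremum over bounded intervals `I` of
`v(I)⁻¹ ∫_I M(v 1_I)`. (If `v` vanishes a.e. on `I`, the quotient is `0 / 0 = 0`.) -/
def fujiiWilson (v : ℝ → ℝ) : ℝ≥0∞ :=
  ⨆ (a : ℝ) (b : ℝ) (_ : a < b),
    (∫⁻ t in Ioo a b, hlMaximal ((Ioo a b).indicator fun u => ENNReal.ofReal (v u)) t) /
      ∫⁻ t in Ioo a b, ENNReal.ofReal (v t)

/-- The one-dimensional section of `w` in direction `j` through the point `y` of the space of
the remaining coordinates. -/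
def lineSection {d : ℕ} (w : (Fin (d + 1) → ℝ) → ℝ) (j : Fin (d + 1)) (y : Fin d → ℝ) :
    ℝ → ℝ :=
  fun t => w (j.insertNth t y)

/-- The strong `A_∞` constant: the largest, over the coordinate directions, of the essential
suprema of the Fujii-Wilson constants of the one-dimensional sections of `w`. -/
def strongAInftyConst {d : ℕ} (w : (Fin (d + 1) → ℝ) → ℝ) : ℝ≥0∞ :=
  ⨆ j : Fin (d + 1), essSup (fun y : Fin d → ℝ => fujiiWilson (lineSection w j y)) volume

/-- Strong Muckenhoupt (`A_∞^*`) weights. -/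
def StrongAInfty {d : ℕ} (w : (Fin (d + 1) → ℝ) → ℝ) : Prop :=
  IsWeight w ∧ strongAInftyConst w < ∞

/-- The measure `w(E) = ∫_E w`. -/
def weightMeasure {n : ℕ} (w : (Fin n → ℝ) → ℝ) : Measure (Fin n → ℝ) :=
  volume.withDensity fun x => ENNReal.ofReal (w x)

/-- The weighted sharp Tauberian constant of the strong maximal operator. -/
def tauberian {n : ℕ} (w : (Fin n → ℝ) → ℝ) (α : ℝ) : ℝ≥0∞ :=
  ⨆ (E : Set (Fin n → ℝ)) (_ : MeasurableSet E) (_ : 0 < weightMeasure w E)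
    (_ : weightMeasure w E < ∞),
    weightMeasure w {x | ENNReal.ofReal α < strongMaximal (E.indicator fun _ => 1) x} /
      weightMeasure w E

/-- The Solyanik estimate `C(α) - 1 ≤ B (1 - α)^(1/β)` for all `1 > α > 1 - e^(-γ)`. -/
def SolyanikEstimate {n : ℕ} (w : (Fin n → ℝ) → ℝ) (B β γ : ℝ) : Prop :=
  ∀ α : ℝ, 1 - Real.exp (-γ) < α → α < 1 →
    tauberian w α ≤ 1 + ENNReal.ofReal (B * (1 - α) ^ (1 / β))

end

end Solyanik

namespace Solyanik

/-! Both directions pass through an equivalent form of the Fujii-Wilson condition on lines: sets of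
small relative length in an interval carry a small share of its mass.

On the line, let `Ω_l` be the set where the maximal function localized to an interval `I` exceeds
`l`, with `l` at least the mean over `I`. The components of `Ω_l` have mean at most `l`, and on each
of them the maximal function sees only that component. Hence a Fujii-Wilson bound `A` localizes to
`Ω_l`, and summing over dyadic levels gives `N μ(Ω_{2^N l}) ≤ 2A μ(Ω_l)`. With `N ≈ 4A` the mass
halves, so it decays geometrically. Outside `Ω_l` the density is at most `l`, and optimizing the
level gives `μ(S) ≤ 4 δ^(1/(6A)) μ(I)` whenever `|S| ≤ δ|I|` (`FujiiWilsonLE.measure_le`). A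
covering of overlap two turns this into a one-dimensional Tauberian estimate
(`FujiiWilsonLE.tauberian_line`).

In dimension `n` the set `E` is enlarged one coordinate direction at a time; by Fubini each
enlargement multiplies the weight by at most `1 + 16 η^(1/(6A))`. A rectangle of which `E` misses
less than the fraction `η^n` ends up inside the final set (`exists_enlargement`), so `η =
(1-α)^(1/n)` bounds the superlevel set of the strong maximal function. This is where the factor `n`
in the exponent comes from.

Conversely, if `C(1-δ) ≤ 3/2`, testing on `R \ G` shows that `G ⊆ R` with `|G| < δ|R|` carries at
most half of the mass of `R` (`two_mul_weightMeasure_le`). Differentiating along cylinders with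
shrinking base passes this to almost every line. There it makes `μ(Ω_{2^k l})` halve every `N ≈
log(1/δ)` steps, and a dyadic layer-cake sum bounds the Fujii-Wilson constant by `1 + 4N`
(`fujiiWilsonLE_of_half`). -/

/-! ### Coverings of the line with overlap two -/

/-- A finite family of open intervals has a subfamily with the same union in which no point is
covered more than twice. -/
lemma exists_subfamily_overlap_le_two (s : Finset (ℝ × ℝ)) :
    ∃ t ⊆ s, (⋃ I ∈ t, Ioo I.1 I.2) = (⋃ I ∈ s, Ioo I.1 I.2) ∧
      ∀ x, (t.filter fun I => x ∈ Ioo I.1 I.2).card ≤ 2 := by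
  induction s using Finset.strongInduction with
  | H s ih =>
    by_cases h : ∀ x, (s.filter fun I => x ∈ Ioo I.1 I.2).card ≤ 2
    · exact ⟨s, subset_rfl, rfl, h⟩
    push Not at h
    obtain ⟨x, hx⟩ := h
    set F := s.filter fun I => x ∈ Ioo I.1 I.2 with hF
    have hne : F.Nonempty := Finset.card_pos.1 (by omega)
    obtain ⟨I, hI, hImin⟩ := F.exists_min_image (fun I => I.1) hne
    obtain ⟨J, hJ, hJmax⟩ := F.exists_max_image (fun I => I.2) hne
    -- Among three intervals through `x`, the one reaching furthest left and the one reaching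
    -- furthest right already cover the third, which can be discarded.
    have : ∃ K ∈ F, K ∉ ({I, J} : Finset (ℝ × ℝ)) :=
      Finset.exists_mem_notMem_of_card_lt_card (lt_of_le_of_lt Finset.card_le_two hx)
    obtain ⟨K, hK, hKn⟩ := this
    simp only [Finset.mem_insert, Finset.mem_singleton, not_or] at hKn
    have hKs : K ∈ s := (Finset.mem_filter.1 hK).1
    obtain ⟨t, ht, htU, htc⟩ := ih (s.erase K) (Finset.erase_ssubset hKs)
    refine ⟨t, ht.trans (Finset.erase_subset _ _), htU.trans ?_, htc⟩
    refine subset_antisymm (biUnion_subset_biUnion_left fun L hL => Finset.mem_of_mem_erase hL) ?_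
    refine iUnion₂_subset fun L hL y hy => ?_
    by_cases hLK : L = K
    · subst hLK
      have h1 := hImin L hK
      have h2 := hJmax L hK
      have hxI := (Finset.mem_filter.1 hI).2
      have hxJ := (Finset.mem_filter.1 hJ).2
      rcases le_or_gt y x with hyx | hyx
      · exact mem_biUnion (x := I)
          (Finset.mem_coe.2 (Finset.mem_erase.2 ⟨Ne.symm hKn.1, (Finset.mem_filter.1 hI).1⟩))
          ⟨h1.trans_lt hy.1, hyx.trans_lt hxI.2⟩
      · exact mem_biUnion (x := J)
          (Finset.mem_coe.2 (Finset.mem_erase.2 ⟨Ne.symm hKn.2, (Finset.mem_filter.1 hJ).1⟩))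
          ⟨hxJ.1.trans hyx, hy.2.trans_le h2⟩
    · exact mem_biUnion (x := L) (Finset.mem_coe.2 (Finset.mem_erase.2 ⟨hLK, hL⟩)) hy

/-- Comparison of two measures on a finite union of intervals from a comparison on each. -/
lemma measure_biUnion_finset_Ioo_le {ν ρ : Measure ℝ} (s : Finset (ℝ × ℝ))
    (h : ∀ I ∈ s, ν (Ioo I.1 I.2) ≤ ρ (Ioo I.1 I.2)) :
    ν (⋃ I ∈ s, Ioo I.1 I.2) ≤ 2 * ρ (⋃ I ∈ s, Ioo I.1 I.2) := by
  obtain ⟨t, hts, htU, htc⟩ := exists_subfamily_overlap_le_two s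
  rw [← htU]
  set V := ⋃ I ∈ t, Ioo I.1 I.2 with hV
  have hVm : MeasurableSet V := Finset.measurableSet_biUnion _ fun I _ => measurableSet_Ioo
  calc ν V ≤ ∑ I ∈ t, ν (Ioo I.1 I.2) := measure_biUnion_finset_le _ _
    _ ≤ ∑ I ∈ t, ρ (Ioo I.1 I.2) := Finset.sum_le_sum fun I hI => h I (hts hI)
    _ = ∑ I ∈ t, ∫⁻ x, (Ioo I.1 I.2).indicator 1 x ∂ρ := by
        refine Finset.sum_congr rfl fun I _ => (lintegral_indicator_one measurableSet_Ioo).symm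
    _ = ∫⁻ x, ∑ I ∈ t, (Ioo I.1 I.2).indicator 1 x ∂ρ :=
        (lintegral_finsetSum _ fun I _ => measurable_one.indicator measurableSet_Ioo).symm
    _ ≤ ∫⁻ x, V.indicator (fun _ => 2) x ∂ρ := by
        refine lintegral_mono fun x => ?_
        by_cases hx : x ∈ V
        · have : ∑ I ∈ t, (Ioo I.1 I.2).indicator (1 : ℝ → ℝ≥0∞) x
              = ((t.filter fun I => x ∈ Ioo I.1 I.2).card : ℝ≥0∞) := by
            simp only [Finset.card_filter, indicator_apply, Pi.one_apply]
            push_cast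
            rfl
          simp only [this, indicator_of_mem hx]
          exact_mod_cast htc x
        · simp only [indicator_of_notMem hx, nonpos_iff_eq_zero]
          refine Finset.sum_eq_zero fun I hI => indicator_of_notMem (fun hxI => hx ?_) _
          exact mem_biUnion (Finset.mem_coe.2 hI) hxI
    _ = 2 * ρ V := by rw [lintegral_indicator hVm, setLIntegral_const]

lemma measure_iUnion_le_of_finset {α ι : Type*} [MeasurableSpace α] [Countable ι] {ν : Measure α}
    {f : ι → Set α} {c : ℝ≥0∞} (h : ∀ s : Finset ι, ν (⋃ i ∈ s, f i) ≤ c) :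
    ν (⋃ i, f i) ≤ c := by
  rw [iUnion_eq_iUnion_finset, Directed.measure_iUnion]
  · exact iSup_le h
  · exact directed_of_isDirected_le fun s t hst => biUnion_subset_biUnion_left hst

lemma measure_biUnion_Ioo_le_of_finset {ν : Measure ℝ} {T : Set (ℝ × ℝ)} {c : ℝ≥0∞}
    (h : ∀ s : Finset (ℝ × ℝ), ↑s ⊆ T → ν (⋃ I ∈ s, Ioo I.1 I.2) ≤ c) :
    ν (⋃ I ∈ T, Ioo I.1 I.2) ≤ c := by
  classical
  obtain ⟨T', hT', hc, hU⟩ := TopologicalSpace.isOpen_biUnion_countable T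
    (fun I => Ioo I.1 I.2) (fun I _ => isOpen_Ioo)
  rw [← hU, biUnion_eq_iUnion]
  have := hc.to_subtype
  refine measure_iUnion_le_of_finset fun s => ?_
  have hs : (⋃ i ∈ s, Ioo (i : ℝ × ℝ).1 (i : ℝ × ℝ).2)
      = ⋃ I ∈ s.image (Subtype.val), Ioo I.1 I.2 := by
    rw [Finset.set_biUnion_finset_image]
  rw [hs]
  refine h _ fun I hI => ?_
  obtain ⟨i, -, rfl⟩ := Finset.mem_image.1 hI
  exact hT' i.2

/-- Comparison of two measures on an arbitrary union of open intervals. -/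
lemma measure_biUnion_Ioo_le {ν ρ : Measure ℝ} (T : Set (ℝ × ℝ))
    (h : ∀ I ∈ T, ν (Ioo I.1 I.2) ≤ ρ (Ioo I.1 I.2)) :
    ν (⋃ I ∈ T, Ioo I.1 I.2) ≤ 2 * ρ (⋃ I ∈ T, Ioo I.1 I.2) := by
  refine measure_biUnion_Ioo_le_of_finset fun s hs =>
    (measure_biUnion_finset_Ioo_le (ρ := ρ) s fun I hI => h I (hs hI)).trans ?_
  exact mul_le_mul_right (measure_mono (biUnion_subset_biUnion_left hs)) _

/-! ### Components of open sets -/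

/-- The connected components of a subset of the line, as intervals given by their endpoints. -/
def components (U : Set ℝ) : Set (ℝ × ℝ) :=
  {I | I.1 < I.2 ∧ I.1 ∉ U ∧ I.2 ∉ U ∧ Ioo I.1 I.2 ⊆ U}

lemma components_pairwiseDisjoint (U : Set ℝ) :
    (components U).PairwiseDisjoint fun I => Ioo I.1 I.2 := by
  intro I hI J hJ hne
  refine disjoint_left.2 fun x hxI hxJ => hne ?_
  have key : ∀ K ∈ components U, ∀ L ∈ components U, x ∈ Ioo K.1 K.2 → x ∈ Ioo L.1 L.2 →
      K.1 ≤ L.1 ∧ L.2 ≤ K.2 := by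
    intro K hK L hL hxK hxL
    constructor
    · by_contra! h
      exact hK.2.1 (hL.2.2.2 ⟨h, hxK.1.trans hxL.2⟩)
    · by_contra! h
      exact hK.2.2.1 (hL.2.2.2 ⟨hxL.1.trans hxK.2, h⟩)
  have h1 := key I hI J hJ hxI hxJ
  have h2 := key J hJ I hI hxJ hxI
  exact Prod.ext (le_antisymm h1.1 h2.1) (le_antisymm h2.2 h1.2)

lemma components_countable (U : Set ℝ) : (components U).Countable :=
  (components_pairwiseDisjoint U).countable_of_isOpen (fun _ _ => isOpen_Ioo)
    fun _ hI => nonempty_Ioo.2 hI.1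

lemma biUnion_components {U : Set ℝ} (hU : IsOpen U) {a b : ℝ} (hab : U ⊆ Ioo a b) :
    ⋃ I ∈ components U, Ioo I.1 I.2 = U := by
  refine subset_antisymm (iUnion₂_subset fun I hI => hI.2.2.2) fun x hx => ?_
  have hxab := hab hx
  have hA : IsClosed (Uᶜ ∩ Iic x) := hU.isClosed_compl.inter isClosed_Iic
  have hB : IsClosed (Uᶜ ∩ Ici x) := hU.isClosed_compl.inter isClosed_Ici
  have hAne : (Uᶜ ∩ Iic x).Nonempty := ⟨a, fun h => lt_irrefl _ (hab h).1, hxab.1.le⟩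
  have hBne : (Uᶜ ∩ Ici x).Nonempty := ⟨b, fun h => lt_irrefl _ (hab h).2, hxab.2.le⟩
  have hAb : BddAbove (Uᶜ ∩ Iic x) := ⟨x, fun y hy => hy.2⟩
  have hBb : BddBelow (Uᶜ ∩ Ici x) := ⟨x, fun y hy => hy.2⟩
  have hp := hA.csSup_mem hAne hAb
  have hq := hB.csInf_mem hBne hBb
  set p := sSup (Uᶜ ∩ Iic x)
  set q := sInf (Uᶜ ∩ Ici x)
  have hpx : p < x := lt_of_le_of_ne hp.2 fun h => hp.1 (h ▸ hx)
  have hxq : x < q := lt_of_le_of_ne hq.2 fun h => hq.1 (h ▸ hx)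
  refine mem_biUnion (x := (p, q)) ⟨hpx.trans hxq, hp.1, hq.1, fun y hy => ?_⟩ ⟨hpx, hxq⟩
  by_contra hyU
  rcases le_total y x with h | h
  · exact absurd (le_csSup hAb ⟨hyU, h⟩) (not_le.2 hy.1)
  · exact absurd (csInf_le hBb ⟨hyU, h⟩) (not_le.2 hy.2)

/-! ### The localized maximal function and its superlevel sets -/

/-- The maximal function of a measure, localized to the interval with endpoints `a`, `b`. -/
noncomputable def maxOn (μ : Measure ℝ) (a b x : ℝ) : ℝ≥0∞ :=
  ⨆ (s : ℝ) (t : ℝ) (_ : x ∈ Ioo s t) (_ : a ≤ s) (_ : t ≤ b), μ (Ioo s t) / volume (Ioo s t)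

lemma lt_maxOn_iff {μ : Measure ℝ} {a b x : ℝ} {l : ℝ≥0∞} :
    l < maxOn μ a b x ↔
      ∃ s t, x ∈ Ioo s t ∧ a ≤ s ∧ t ≤ b ∧ l * volume (Ioo s t) < μ (Ioo s t) := by
  simp only [maxOn, lt_iSup_iff, exists_prop]
  refine exists_congr fun s => exists_congr fun t => and_congr_right fun hx =>
    and_congr_right fun _ => and_congr_right fun _ => ?_
  rw [ENNReal.lt_div_iff_mul_lt]
  · left
    simpa using hx.1.trans hx.2
  · left
    simp

/-- The superlevel sets of the localized maximal function. -/
def superlevel (μ : Measure ℝ) (a b : ℝ) (l : ℝ≥0∞) : Set ℝ := {x | l < maxOn μ a b x}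

lemma mem_superlevel {μ : Measure ℝ} {a b x : ℝ} {l : ℝ≥0∞} :
    x ∈ superlevel μ a b l ↔ l < maxOn μ a b x := Iff.rfl

lemma superlevel_eq_biUnion (μ : Measure ℝ) (a b : ℝ) (l : ℝ≥0∞) :
    superlevel μ a b l = ⋃ I ∈ {I : ℝ × ℝ | a ≤ I.1 ∧ I.2 ≤ b ∧
      l * volume (Ioo I.1 I.2) < μ (Ioo I.1 I.2)}, Ioo I.1 I.2 := by
  ext x
  simp only [superlevel, mem_ofPred_eq, lt_maxOn_iff, mem_iUnion, exists_prop, Prod.exists]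
  refine exists_congr fun s => exists_congr fun t => ?_
  tauto

lemma isOpen_superlevel (μ : Measure ℝ) (a b : ℝ) (l : ℝ≥0∞) : IsOpen (superlevel μ a b l) := by
  rw [superlevel_eq_biUnion]
  exact isOpen_biUnion fun _ _ => isOpen_Ioo

lemma measurable_maxOn (μ : Measure ℝ) (a b : ℝ) : Measurable (maxOn μ a b) :=
  measurable_of_Ioi fun l => (isOpen_superlevel μ a b l).measurableSet

lemma superlevel_subset (μ : Measure ℝ) (a b : ℝ) (l : ℝ≥0∞) :
    superlevel μ a b l ⊆ Ioo a b := by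
  intro x hx
  obtain ⟨s, t, hx, hs, ht, -⟩ := lt_maxOn_iff.1 hx
  exact ⟨hs.trans_lt hx.1, hx.2.trans_le ht⟩

lemma superlevel_anti (μ : Measure ℝ) (a b : ℝ) : Antitone (superlevel μ a b) :=
  fun _ _ h _ hx => lt_of_le_of_lt h hx

lemma endpoints_of_mem_components {μ : Measure ℝ} {a b : ℝ} {l : ℝ≥0∞} {I : ℝ × ℝ}
    (hI : I ∈ components (superlevel μ a b l)) : a ≤ I.1 ∧ I.2 ≤ b :=
  (Ioo_subset_Ioo_iff hI.1).1 (hI.2.2.2.trans (superlevel_subset μ a b l))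

/-- An interval of mean above `l` lies in the superlevel set, so it cannot contain an endpoint of a
component. -/
lemma le_endpoints_of_mem_components {μ : Measure ℝ} {a b : ℝ} {l : ℝ≥0∞} {I : ℝ × ℝ}
    (hI : I ∈ components (superlevel μ a b l)) {x s t : ℝ} (hx : x ∈ Ioo I.1 I.2)
    (hxst : x ∈ Ioo s t) (hs : a ≤ s) (ht : t ≤ b)
    (hl : l * volume (Ioo s t) < μ (Ioo s t)) : I.1 ≤ s ∧ t ≤ I.2 := by
  have hsub : Ioo s t ⊆ superlevel μ a b l := fun y hy => lt_maxOn_iff.2 ⟨s, t, hy, hs, ht, hl⟩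
  constructor
  · by_contra! h
    exact hI.2.1 (hsub ⟨h, hx.1.trans hxst.2⟩)
  · by_contra! h
    exact hI.2.2.1 (hsub ⟨hxst.1.trans hx.2, h⟩)

/-- On a component of a superlevel set the maximal function only sees that component. -/
lemma maxOn_eq_of_mem_components {μ : Measure ℝ} {a b : ℝ} {l : ℝ≥0∞} {I : ℝ × ℝ}
    (hI : I ∈ components (superlevel μ a b l)) {x : ℝ} (hx : x ∈ Ioo I.1 I.2) :
    maxOn μ a b x = maxOn μ I.1 I.2 x := by
  obtain ⟨ha, hb⟩ := endpoints_of_mem_components hI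
  refine le_antisymm (le_of_forall_lt fun c hc => ?_) (le_of_forall_lt fun c hc => ?_)
  · have hm : max c l < maxOn μ a b x := max_lt hc (hI.2.2.2 hx)
    obtain ⟨s, t, hst, hs, ht, h⟩ := lt_maxOn_iff.1 hm
    have hlt : l * volume (Ioo s t) < μ (Ioo s t) :=
      lt_of_le_of_lt (mul_le_mul_left (le_max_right c l) _) h
    obtain ⟨h1, h2⟩ := le_endpoints_of_mem_components hI hx hst hs ht hlt
    exact lt_of_le_of_lt (le_max_left c l) (lt_maxOn_iff.2 ⟨s, t, hst, h1, h2, h⟩)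
  · obtain ⟨s, t, hst, hs, ht, h⟩ := lt_maxOn_iff.1 hc
    exact lt_maxOn_iff.2 ⟨s, t, hst, ha.trans hs, ht.trans hb, h⟩

/-- Above the average level the mean of the measure on a component is at most the level. -/
lemma measure_component_le {μ : Measure ℝ} {a b : ℝ} {l : ℝ≥0∞}
    (hl : μ (Ioo a b) ≤ l * volume (Ioo a b)) {I : ℝ × ℝ}
    (hI : I ∈ components (superlevel μ a b l)) :
    μ (Ioo I.1 I.2) ≤ l * volume (Ioo I.1 I.2) := by
  obtain ⟨ha, hb⟩ := endpoints_of_mem_components hI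
  obtain ⟨p, q⟩ := I
  obtain ⟨hpq, hp, hq, -⟩ := hI
  simp only at *
  rcases eq_or_ne l ∞ with rfl | hlt
  · rw [ENNReal.top_mul (by simpa using hpq)]
    exact le_top
  -- An endpoint different from `a`, `b` can be pushed slightly outwards. The longer interval
  -- contains a point off the superlevel set, so its mean is at most `l`; the shift then tends to
  -- zero. If neither endpoint can move, the component is the whole interval.
  rcases ha.eq_or_lt with rfl | ha
  · rcases hb.eq_or_lt with rfl | hb
    · exact hl
    · have hlim : Filter.Tendsto (fun t : ℝ => l * ENNReal.ofReal (t - a)) (nhdsWithin q (Ioi q))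
          (nhds (l * ENNReal.ofReal (q - a))) := by
        refine ENNReal.Tendsto.const_mul ?_ (Or.inr hlt)
        exact (ENNReal.continuous_ofReal.comp (continuous_id.sub continuous_const)).continuousAt.tendsto.mono_left
          nhdsWithin_le_nhds
      rw [Real.volume_Ioo]
      refine ge_of_tendsto hlim ?_
      filter_upwards [Ioo_mem_nhdsGT hb] with t ht
      have : ¬ l * volume (Ioo a t) < μ (Ioo a t) := fun h =>
        hq (lt_maxOn_iff.2 ⟨a, t, ⟨hpq, ht.1⟩, le_rfl, ht.2.le, h⟩)
      rw [Real.volume_Ioo] at this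
      exact (measure_mono (Ioo_subset_Ioo_right ht.1.le)).trans (not_lt.1 this)
  · have hlim : Filter.Tendsto (fun t : ℝ => l * ENNReal.ofReal (q - t)) (nhdsWithin p (Iio p))
        (nhds (l * ENNReal.ofReal (q - p))) := by
      refine ENNReal.Tendsto.const_mul ?_ (Or.inr hlt)
      exact (ENNReal.continuous_ofReal.comp (continuous_const.sub continuous_id)).continuousAt.tendsto.mono_left
        nhdsWithin_le_nhds
    rw [Real.volume_Ioo]
    refine ge_of_tendsto hlim ?_
    filter_upwards [Ioo_mem_nhdsLT ha] with t ht
    have : ¬ l * volume (Ioo t q) < μ (Ioo t q) := fun h =>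
      hp (lt_maxOn_iff.2 ⟨t, q, ⟨ht.2, hpq⟩, ht.1.le, hb, h⟩)
    rw [Real.volume_Ioo] at this
    exact (measure_mono (Ioo_subset_Ioo_left ht.2.le)).trans (not_lt.1 this)

lemma setLIntegral_superlevel_eq_tsum (ν μ : Measure ℝ) (a b : ℝ) (l : ℝ≥0∞) (f : ℝ → ℝ≥0∞) :
    ∫⁻ x in superlevel μ a b l, f x ∂ν
      = ∑' I : components (superlevel μ a b l), ∫⁻ x in Ioo I.1.1 I.1.2, f x ∂ν := by
  conv_lhs => rw [← biUnion_components (isOpen_superlevel μ a b l) (superlevel_subset μ a b l)]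
  exact lintegral_biUnion (components_countable _) (fun _ _ => measurableSet_Ioo)
    (components_pairwiseDisjoint _) _

lemma measure_superlevel_eq_tsum (ν μ : Measure ℝ) (a b : ℝ) (l : ℝ≥0∞) :
    ν (superlevel μ a b l)
      = ∑' I : components (superlevel μ a b l), ν (Ioo I.1.1 I.1.2) := by
  simpa using setLIntegral_superlevel_eq_tsum ν μ a b l fun _ => 1

lemma measure_superlevel_le {μ : Measure ℝ} {a b : ℝ} {l : ℝ≥0∞}
    (hl : μ (Ioo a b) ≤ l * volume (Ioo a b)) :
    μ (superlevel μ a b l) ≤ l * volume (superlevel μ a b l) := by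
  rw [measure_superlevel_eq_tsum, measure_superlevel_eq_tsum volume, ← ENNReal.tsum_mul_left]
  exact ENNReal.tsum_le_tsum fun I => measure_component_le hl I.2

/-! ### From the Fujii-Wilson condition to a Tauberian estimate on the line -/

/-- A measure on the line satisfies the Fujii-Wilson condition with constant `A`. -/
def FujiiWilsonLE (μ : Measure ℝ) (A : ℝ≥0∞) : Prop :=
  ∀ a b, a < b → ∫⁻ x in Ioo a b, maxOn μ a b x ≤ A * μ (Ioo a b)

lemma FujiiWilsonLE.setLIntegral_superlevel_le {μ : Measure ℝ} {A : ℝ≥0∞}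
    (hA : FujiiWilsonLE μ A) (a b : ℝ) (l : ℝ≥0∞) :
    ∫⁻ x in superlevel μ a b l, maxOn μ a b x ≤ A * μ (superlevel μ a b l) := by
  rw [measure_superlevel_eq_tsum, setLIntegral_superlevel_eq_tsum, ← ENNReal.tsum_mul_left]
  refine ENNReal.tsum_le_tsum fun I => ?_
  rw [setLIntegral_congr_fun measurableSet_Ioo fun x hx => maxOn_eq_of_mem_components I.2 hx]
  exact hA _ _ I.2.1

/-- A geometric sum of ratio two is at most twice its last term, here a term below `u`. -/
lemma sum_two_pow_mul_indicator_le (l u : ℝ≥0∞) (N : ℕ) :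
    (∑ j ∈ Finset.range N, if 2 ^ (j + 1) * l < u then 2 ^ (j + 1) * l else 0) ≤
      if l < u then 2 * u else 0 := by
  have hmono : ∀ j : ℕ, l ≤ 2 ^ j * l := fun j => le_mul_of_one_le_left' (one_le_pow₀ one_le_two)
  split_ifs with hu
  · have hgeom : ∀ N : ℕ, (∑ j ∈ Finset.range N, if 2 ^ (j + 1) * l < u then 2 ^ (j + 1) * l else 0)
        ≤ 2 * (2 ^ N * l) := by
      intro N
      induction N with
      | zero => simp
      | succ N ih =>
        rw [Finset.sum_range_succ]
        calc _ ≤ 2 * (2 ^ N * l) + 2 ^ (N + 1) * l := by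
              gcongr
              split_ifs <;> simp
          _ = _ := by ring
    induction N with
    | zero => simp
    | succ N ih =>
      by_cases hN : 2 ^ (N + 1) * l < u
      · exact (hgeom _).trans (by gcongr)
      · rw [Finset.sum_range_succ, if_neg hN, add_zero]
        exact ih
  · refine le_of_eq (Finset.sum_eq_zero fun j _ => if_neg fun h => hu ?_)
    exact (hmono _).trans_lt h

/-- Decay of the mass of superlevel sets under the Fujii-Wilson condition. -/
lemma FujiiWilsonLE.nat_mul_measure_superlevel_le {μ : Measure ℝ} {A : ℝ≥0∞}
    (hA : FujiiWilsonLE μ A) {a b : ℝ} {l : ℝ≥0∞}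
    (hl : μ (Ioo a b) ≤ l * volume (Ioo a b)) (N : ℕ) :
    N * μ (superlevel μ a b (2 ^ N * l)) ≤ 2 * A * μ (superlevel μ a b l) := by
  have hmono : ∀ j : ℕ, l ≤ 2 ^ j * l := fun j => le_mul_of_one_le_left' (one_le_pow₀ one_le_two)
  calc (N : ℝ≥0∞) * μ (superlevel μ a b (2 ^ N * l))
      = ∑ j ∈ Finset.range N, μ (superlevel μ a b (2 ^ N * l)) := by simp
    -- All levels `2 ^ (j + 1) * l` with `j < N` are at most `2 ^ N * l`, so each of the `N` copies
    -- can be bounded at its own level, where the components have mean at most that level.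
    _ ≤ ∑ j ∈ Finset.range N, 2 ^ (j + 1) * l * volume (superlevel μ a b (2 ^ (j + 1) * l)) := by
        refine Finset.sum_le_sum fun j hj => ?_
        refine le_trans (measure_mono (superlevel_anti μ a b ?_))
          (measure_superlevel_le (hl.trans (mul_le_mul_left (hmono _) _)))
        gcongr
        · exact one_le_two
        · exact Finset.mem_range.1 hj
    _ = ∑ j ∈ Finset.range N, ∫⁻ x, if 2 ^ (j + 1) * l < maxOn μ a b x
          then 2 ^ (j + 1) * l else 0 := by
        refine Finset.sum_congr rfl fun j _ => ?_
        rw [← setLIntegral_const, ← lintegral_indicator (isOpen_superlevel _ _ _ _).measurableSet]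
        classical
        simp only [indicator_apply, mem_superlevel]
    _ = ∫⁻ x, ∑ j ∈ Finset.range N, if 2 ^ (j + 1) * l < maxOn μ a b x
          then 2 ^ (j + 1) * l else 0 := by
        refine (lintegral_finsetSum _ fun j _ => ?_).symm
        exact Measurable.ite (isOpen_superlevel _ _ _ _).measurableSet measurable_const
          measurable_const
    _ ≤ ∫⁻ x, if l < maxOn μ a b x then 2 * maxOn μ a b x else 0 :=
        lintegral_mono fun x => sum_two_pow_mul_indicator_le _ _ _
    _ = ∫⁻ x in superlevel μ a b l, 2 * maxOn μ a b x := by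
        rw [← lintegral_indicator (isOpen_superlevel _ _ _ _).measurableSet]
        classical
        simp only [indicator_apply, mem_superlevel]
    _ ≤ _ := by
        rw [lintegral_const_mul _ (measurable_maxOn _ _ _), mul_assoc]
        gcongr
        exact hA.setLIntegral_superlevel_le a b l

lemma two_pow_mul_measure_superlevel_le {μ : Measure ℝ} {a b : ℝ} {l : ℝ≥0∞} {N : ℕ}
    (h : ∀ k : ℕ, 2 * μ (superlevel μ a b (2 ^ (k + N) * l)) ≤ μ (superlevel μ a b (2 ^ k * l)))
    (m : ℕ) : 2 ^ m * μ (superlevel μ a b (2 ^ (m * N) * l)) ≤ μ (Ioo a b) := by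
  induction m with
  | zero => simpa using measure_mono (superlevel_subset μ a b l)
  | succ m ih =>
    refine le_trans ?_ ih
    rw [pow_succ, mul_assoc, Nat.succ_mul]
    gcongr
    exact h _

/-- Off a superlevel set, the measure is dominated by the level times Lebesgue measure. -/
lemma measure_diff_superlevel_le {μ : Measure ℝ} (hμ : μ ≪ volume) {a b : ℝ} {l : ℝ≥0∞}
    (hl : l ≠ ∞) {S : Set ℝ} (hS : S ⊆ Ioo a b) :
    μ (S \ superlevel μ a b l) ≤ l * volume S := by
  have : NullSingletonClass μ := ⟨fun x => hμ (measure_singleton x)⟩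
  lift l to NNReal using hl
  have key := (Besicovitch.vitaliFamily (volume : Measure ℝ)).measure_le_of_frequently_le
    (l • (volume : Measure ℝ)) hμ (S \ superlevel μ a b l) fun x hx => ?_
  · refine key.trans ?_
    rw [Measure.smul_apply, ENNReal.smul_def, smul_eq_mul]
    gcongr
    exact sdiff_subset
  · refine (Besicovitch.tendsto_filterAt volume x).frequently (Filter.Eventually.frequently ?_)
    have hxab := hS hx.1
    -- Small intervals centred at a point off the superlevel set stay in `(a, b)`, so their mean is
    -- at most `l`.
    filter_upwards [Ioo_mem_nhdsGT (show 0 < min (x - a) (b - x) from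
      lt_min (by linarith [hxab.1]) (by linarith [hxab.2]))] with r hr
    have h1 := lt_min_iff.1 hr.2
    have hn := fun h => hx.2 (lt_maxOn_iff.2 ⟨x - r, x + r, ⟨by linarith [hr.1], by linarith [hr.1]⟩,
      by linarith, by linarith, h⟩)
    rw [Real.closedBall_eq_Icc, Measure.smul_apply, ← measure_congr Ioo_ae_eq_Icc,
      ← measure_congr Ioo_ae_eq_Icc, ENNReal.smul_def, smul_eq_mul]
    exact not_lt.1 hn

/-- Write `N = ⌈4A⌉` and take the largest `m` with `2^(m(N+1)) ≤ 1/δ`. Both terms are then at most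
`2^(-m)`, maximality gives `2^(-(m+1)) ≤ δ^(1/(N+1))`, and `N + 1 ≤ 4A + 2 ≤ 6A`. -/
lemma exists_nat_two_pow_mul_add_le {A δ : ℝ} (hA : 1 ≤ A) (hδ : 0 < δ) (hδ1 : δ ≤ 1) :
    ∃ m : ℕ, 2 ^ (m * ⌈4 * A⌉₊) * δ + (2 ^ m)⁻¹ ≤ 4 * δ ^ (1 / (6 * A)) := by
  set N := ⌈4 * A⌉₊ with hN
  have hN1 : (N : ℝ) < 4 * A + 1 := Nat.ceil_lt_add_one (by linarith)
  obtain ⟨m, hm1, hm2⟩ := exists_nat_pow_near (one_le_inv₀ hδ |>.2 hδ1)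
    (show (1 : ℝ) < 2 ^ (N + 1) from one_lt_pow₀ one_lt_two (by omega))
  refine ⟨m, ?_⟩
  have hb1 : 2 ^ (m * N) * δ ≤ ((2 : ℝ) ^ m)⁻¹ := by
    rw [le_inv_comm₀ (by positivity) (by positivity), mul_inv, ← div_eq_inv_mul,
      le_div_iff₀ (by positivity)]
    refine le_trans (le_of_eq ?_) hm1
    rw [← pow_add, ← pow_mul]
    congr 1
    ring
  have hb2 : ((2 : ℝ) ^ (m + 1))⁻¹ ≤ δ ^ (1 / (6 * A)) := by
    have h1 : (((2 : ℝ) ^ (N + 1)) ^ (m + 1))⁻¹ ≤ δ := by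
      rw [inv_le_comm₀ (by positivity) hδ]
      exact hm2.le
    calc ((2 : ℝ) ^ (m + 1))⁻¹ = ((((2 : ℝ) ^ (N + 1)) ^ (m + 1))⁻¹) ^ (1 / ((N : ℝ) + 1)) := by
          rw [Real.inv_rpow (by positivity), ← pow_mul, mul_comm, pow_mul]
          congr 1
          have := Real.pow_rpow_inv_natCast (x := (2 : ℝ) ^ (m + 1)) (by positivity)
            (Nat.succ_ne_zero N)
          rw [one_div]
          push_cast at this
          exact this.symm
      _ ≤ δ ^ (1 / ((N : ℝ) + 1)) := Real.rpow_le_rpow (by positivity) h1 (by positivity)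
      _ ≤ δ ^ (1 / (6 * A)) := by
          refine Real.rpow_le_rpow_of_exponent_ge hδ hδ1 ?_
          exact one_div_le_one_div_of_le (by positivity) (by linarith)
  have hb3 : ((2 : ℝ) ^ m)⁻¹ = 2 * ((2 : ℝ) ^ (m + 1))⁻¹ := by
    rw [pow_succ]
    field_simp
  linarith

/-- The quantitative `A_∞` property of a measure with finite Fujii-Wilson constant. -/
lemma FujiiWilsonLE.measure_le {μ : Measure ℝ} {A : ℝ} (hA1 : 1 ≤ A)
    (hA : FujiiWilsonLE μ (ENNReal.ofReal A)) (hμ : μ ≪ volume)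
    (hfin : ∀ a b, μ (Ioo a b) ≠ ∞) {a b δ : ℝ} (hab : a < b) (hδ : 0 < δ) (hδ1 : δ ≤ 1)
    {S : Set ℝ} (hS : S ⊆ Ioo a b)
    (hSδ : volume S ≤ ENNReal.ofReal δ * volume (Ioo a b)) :
    μ S ≤ ENNReal.ofReal (4 * δ ^ (1 / (6 * A))) * μ (Ioo a b) := by
  obtain ⟨m, hm⟩ := exists_nat_two_pow_mul_add_le hA1 hδ hδ1
  set N := ⌈4 * A⌉₊ with hN
  have hv0 : volume (Ioo a b) ≠ 0 := by simpa using hab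
  have hvt : volume (Ioo a b) ≠ ∞ := by simp
  set l := μ (Ioo a b) / volume (Ioo a b) with hl
  have hlt : l ≠ ∞ := ENNReal.div_ne_top (hfin a b) hv0
  have hlv : l * volume (Ioo a b) = μ (Ioo a b) := ENNReal.div_mul_cancel hv0 hvt
  have hmono : ∀ j : ℕ, l ≤ 2 ^ j * l := fun j => le_mul_of_one_le_left' (one_le_pow₀ one_le_two)
  have hA0 : ENNReal.ofReal A ≠ 0 := by simpa using by linarith
  -- `N ≥ 4A` in the decay estimate `N μ(Ω_{2^N l}) ≤ 2A μ(Ω_l)` is what produces halving.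
  have hhalf : ∀ k : ℕ, 2 * μ (superlevel μ a b (2 ^ (k + N) * l)) ≤
      μ (superlevel μ a b (2 ^ k * l)) := by
    intro k
    have h := hA.nat_mul_measure_superlevel_le (a := a) (b := b) (l := 2 ^ k * l)
      (hlv.symm.le.trans (mul_le_mul_left (hmono k) _)) N
    have h4 : 4 * ENNReal.ofReal A ≤ N := by
      have : ENNReal.ofReal (4 * A) ≤ N := by
        rw [← ENNReal.ofReal_natCast]
        exact ENNReal.ofReal_le_ofReal (Nat.le_ceil _)
      rwa [ENNReal.ofReal_mul (by norm_num), ENNReal.ofReal_ofNat] at this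
    rw [← mul_assoc, ← pow_add, add_comm N k] at h
    have h' := (mul_le_mul_left h4 _).trans h
    have h2A0 : 2 * ENNReal.ofReal A ≠ 0 := mul_ne_zero two_ne_zero hA0
    have h2At : 2 * ENNReal.ofReal A ≠ ∞ := ENNReal.mul_ne_top (by simp) ENNReal.ofReal_ne_top
    rw [show (4 : ℝ≥0∞) * ENNReal.ofReal A * μ (superlevel μ a b (2 ^ (k + N) * l))
      = 2 * ENNReal.ofReal A * (2 * μ (superlevel μ a b (2 ^ (k + N) * l))) by ring] at h'
    exact (ENNReal.mul_le_mul_iff_right h2A0 h2At).1 h'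
  have hdecay := two_pow_mul_measure_superlevel_le hhalf m
  set U := superlevel μ a b (2 ^ (m * N) * l) with hU
  have h1 : μ (S \ U) ≤ 2 ^ (m * N) * l * volume S :=
    measure_diff_superlevel_le hμ (ENNReal.mul_ne_top (by finiteness) hlt) hS
  have h2 : μ U ≤ ENNReal.ofReal (2 ^ m)⁻¹ * μ (Ioo a b) := by
    rw [ENNReal.ofReal_inv_of_pos (by positivity), ENNReal.ofReal_pow (by norm_num),
      ENNReal.ofReal_ofNat, ← ENNReal.div_eq_inv_mul,
      ENNReal.le_div_iff_mul_le (Or.inl (by positivity)) (Or.inl (by finiteness)), mul_comm]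
    exact hdecay
  calc μ S ≤ μ (S \ U) + μ U := by
        refine (measure_mono ?_).trans (measure_union_le _ _)
        rw [sdiff_union_self]
        exact subset_union_left
    _ ≤ 2 ^ (m * N) * l * (ENNReal.ofReal δ * volume (Ioo a b)) +
          ENNReal.ofReal (2 ^ m)⁻¹ * μ (Ioo a b) := by
        gcongr
        exact h1.trans (by gcongr)
    _ = ENNReal.ofReal (2 ^ (m * N) * δ + (2 ^ m)⁻¹) * μ (Ioo a b) := by
        rw [ENNReal.ofReal_add (by positivity) (by positivity), add_mul, ← hlv,
          ENNReal.ofReal_mul (by positivity), ENNReal.ofReal_pow (by norm_num),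
          ENNReal.ofReal_ofNat]
        ring
    _ ≤ _ := by gcongr

/-- The weighted Tauberian estimate on the line. -/
lemma FujiiWilsonLE.tauberian_line {μ : Measure ℝ} {A : ℝ} (hA1 : 1 ≤ A)
    (hA : FujiiWilsonLE μ (ENNReal.ofReal A)) (hμ : μ ≪ volume)
    (hfin : ∀ a b, μ (Ioo a b) ≠ ∞) {η : ℝ} (hη : 0 < η) (hη1 : η ≤ 1)
    (hsmall : 16 * η ^ (1 / (6 * A)) ≤ 1) {F : Set ℝ}
    {T : Set (ℝ × ℝ)} (hT : ∀ I ∈ T, I.1 < I.2 ∧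
      volume (Ioo I.1 I.2 \ F) ≤ ENNReal.ofReal η * volume (Ioo I.1 I.2)) :
    μ (⋃ I ∈ T, Ioo I.1 I.2) ≤ ENNReal.ofReal (1 + 16 * η ^ (1 / (6 * A))) * μ F := by
  set θ := η ^ (1 / (6 * A)) with hθ
  have hθ0 : 0 < θ := Real.rpow_pos_of_pos hη _
  refine measure_biUnion_Ioo_le_of_finset fun s hs => ?_
  set V := ⋃ I ∈ s, Ioo I.1 I.2 with hV
  have hVm : MeasurableSet V := Finset.measurableSet_biUnion _ fun I _ => measurableSet_Ioo
  have hVfin : μ V ≠ ∞ := by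
    refine ((measure_biUnion_finset_le s _).trans_lt ?_).ne
    exact ENNReal.sum_lt_top.2 fun I _ => (hfin _ _).lt_top
  have h1 : μ (V \ F) ≤ ENNReal.ofReal (8 * θ) * μ V := by
    have := measure_biUnion_finset_Ioo_le (ν := μ.restrict Fᶜ)
      (ρ := ENNReal.ofReal (4 * θ) • μ) s fun I hI => ?_
    · rw [Measure.restrict_apply hVm, ← sdiff_eq, Measure.smul_apply, smul_eq_mul,
        ← mul_assoc] at this
      rwa [show 8 * θ = 2 * (4 * θ) by ring, ENNReal.ofReal_mul (by norm_num : (0 : ℝ) ≤ 2),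
        ENNReal.ofReal_ofNat]
    · rw [Measure.restrict_apply measurableSet_Ioo, ← sdiff_eq, Measure.smul_apply, smul_eq_mul]
      exact hA.measure_le hA1 hμ hfin (hT I (hs hI)).1 hη hη1 sdiff_subset (hT I (hs hI)).2
  by_cases hFt : μ F = ∞
  · rw [hFt, ENNReal.mul_top (by simpa using by linarith)]
    exact le_top
  have h2 : μ V ≤ μ F + ENNReal.ofReal (8 * θ) * μ V := by
    calc μ V ≤ μ (F ∪ V \ F) := measure_mono (by rw [union_sdiff_self]; exact subset_union_right)
      _ ≤ _ := (measure_union_le _ _).trans (by gcongr)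
  rw [← ENNReal.ofReal_toReal hVfin, ← ENNReal.ofReal_toReal hFt] at h2 ⊢
  rw [← ENNReal.ofReal_mul (by positivity), ← ENNReal.ofReal_add (by positivity) (by positivity),
    ENNReal.ofReal_le_ofReal_iff (by positivity)] at h2
  rw [← ENNReal.ofReal_mul (by positivity)]
  refine ENNReal.ofReal_le_ofReal ?_
  have hv : 0 ≤ (μ V).toReal := ENNReal.toReal_nonneg
  -- The point is `(1 - 8θ)(1 + 16θ) = 1 + 8θ(1 - 16θ) ≥ 1`, by `16θ ≤ 1`.
  nlinarith [mul_nonneg hθ0.le hv, mul_nonneg (mul_nonneg hθ0.le hv) (sub_nonneg.2 hsmall)]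

/-! ### The converse on the line: bounding the Fujii-Wilson constant -/

/-- A weak-type inequality that keeps only the mass inside the superlevel set: this set is a union
of intervals of mean above `l`, and the overlap costs the factor 2. -/
lemma mul_volume_superlevel_le (μ : Measure ℝ) (a b : ℝ) (l : ℝ≥0∞) :
    l * volume (superlevel μ a b l) ≤ 2 * μ (superlevel μ a b l) := by
  have := measure_biUnion_Ioo_le (ν := l • volume) (ρ := μ)
    {I : ℝ × ℝ | a ≤ I.1 ∧ I.2 ≤ b ∧ l * volume (Ioo I.1 I.2) < μ (Ioo I.1 I.2)}
    fun I hI => by simpa using hI.2.2.le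
  rwa [← superlevel_eq_biUnion, Measure.smul_apply, smul_eq_mul] at this

lemma superlevel_inter_component {μ : Measure ℝ} {a b : ℝ} {l l' : ℝ≥0∞} {I : ℝ × ℝ}
    (hI : I ∈ components (superlevel μ a b l)) :
    superlevel μ a b l' ∩ Ioo I.1 I.2 = superlevel μ I.1 I.2 l' := by
  ext x
  constructor
  · rintro ⟨hx, hxI⟩
    rwa [mem_superlevel, ← maxOn_eq_of_mem_components hI hxI]
  · intro hx
    have hxI := superlevel_subset _ _ _ _ hx
    refine ⟨?_, hxI⟩
    rwa [mem_superlevel, maxOn_eq_of_mem_components hI hxI]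

/-- Discrete layer-cake formula: if `k` is least with `u ≤ 2^k l`, then `2^k l` is `l` plus the sum
of all lower levels. -/
lemma le_add_tsum_two_pow {l u : ℝ≥0∞} (hl : l ≠ 0) :
    u ≤ l + ∑' k : ℕ, if 2 ^ k * l < u then 2 ^ k * l else 0 := by
  classical
  by_cases h : ∃ k : ℕ, u ≤ 2 ^ k * l
  · have hgeom : ∀ k : ℕ, l + ∑ j ∈ Finset.range k, 2 ^ j * l = 2 ^ k * l := by
      intro k
      induction k with
      | zero => simp
      | succ k ih => rw [Finset.sum_range_succ, ← add_assoc, ih, pow_succ]; ring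
    calc u ≤ 2 ^ (Nat.find h) * l := Nat.find_spec h
      _ = l + ∑ j ∈ Finset.range (Nat.find h), 2 ^ j * l := (hgeom _).symm
      _ = l + ∑ j ∈ Finset.range (Nat.find h), if 2 ^ j * l < u then 2 ^ j * l else 0 := by
          congr 1
          refine Finset.sum_congr rfl fun j hj => (if_pos ?_).symm
          exact not_le.1 (Nat.find_min h (Finset.mem_range.1 hj))
      _ ≤ _ := by
          gcongr
          exact ENNReal.sum_le_tsum _
  · push Not at h
    have : ∑' _ : ℕ, l ≤ ∑' k : ℕ, if 2 ^ k * l < u then 2 ^ k * l else 0 :=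
      ENNReal.tsum_le_tsum fun k => by
        rw [if_pos (h k)]
        exact le_mul_of_one_le_left' (one_le_pow₀ one_le_two)
    rw [ENNReal.tsum_const_eq_top_of_ne_zero hl, top_le_iff] at this
    rw [this]
    simp

/-- Splitting off the first `N` terms and doubling gives `2S ≤ 2Nc + S` for a partial sum `S`, which
is finite and so cancels. -/
lemma tsum_le_of_halving {f : ℕ → ℝ≥0∞} {c : ℝ≥0∞} (hc : c ≠ ∞) (hf : ∀ k, f k ≤ c) {N : ℕ}
    (hN : ∀ k, 2 * f (k + N) ≤ f k) : ∑' k, f k ≤ 2 * N * c := by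
  refine ENNReal.tsum_le_of_sum_range_le fun n => ?_
  set S := ∑ k ∈ Finset.range n, f k with hS
  have hSt : S ≠ ∞ := (ENNReal.sum_lt_top.2 fun k _ => (hf k).trans_lt hc.lt_top).ne
  have h1 : S ≤ N * c + ∑ k ∈ Finset.range n, f (k + N) := by
    calc S ≤ ∑ k ∈ Finset.range (N + n), f k :=
          Finset.sum_le_sum_of_subset (Finset.range_mono (by omega))
      _ = ∑ k ∈ Finset.range N, f k + ∑ k ∈ Finset.range n, f (N + k) :=
          Finset.sum_range_add _ _ _
      _ ≤ _ := by
          gcongr with k hk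
          · exact (Finset.sum_le_card_nsmul _ _ c fun k _ => hf k).trans (by simp)
          · rw [add_comm]
  have h2 : 2 * S ≤ 2 * N * c + S := by
    calc 2 * S ≤ 2 * (N * c + ∑ k ∈ Finset.range n, f (k + N)) := by gcongr
      _ = 2 * N * c + ∑ k ∈ Finset.range n, 2 * f (k + N) := by
          rw [mul_add, Finset.mul_sum, mul_assoc]
      _ ≤ _ := by
          gcongr
          exact Finset.sum_le_sum fun k _ => hN k
  rw [two_mul] at h2
  exact (ENNReal.add_le_add_iff_right hSt).1 h2

/-- If small open subsets of an interval carry at most half of its mass, the Fujii-Wilson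
constant is controlled by the logarithm of the smallness threshold. -/
lemma fujiiWilsonLE_of_half {μ : Measure ℝ} (hfin : ∀ a b, μ (Ioo a b) ≠ ∞) {N : ℕ}
    (H : ∀ a b, a < b → ∀ U ⊆ Ioo a b, IsOpen U →
      2 ^ N * volume U ≤ 2 * volume (Ioo a b) → 2 * μ U ≤ μ (Ioo a b)) :
    FujiiWilsonLE μ (1 + 4 * N) := by
  intro a b hab
  have hv0 : volume (Ioo a b) ≠ 0 := by simpa using hab
  have hvt : volume (Ioo a b) ≠ ∞ := by simp
  set l := μ (Ioo a b) / volume (Ioo a b) with hl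
  have hlt : l ≠ ∞ := ENNReal.div_ne_top (hfin a b) hv0
  have hlv : l * volume (Ioo a b) = μ (Ioo a b) := ENNReal.div_mul_cancel hv0 hvt
  have hmono : ∀ j : ℕ, l ≤ 2 ^ j * l := fun j => le_mul_of_one_le_left' (one_le_pow₀ one_le_two)
  by_cases hl0 : l = 0
  · have hμ0 : μ (Ioo a b) = 0 := by rw [← hlv, hl0, zero_mul]
    rw [hμ0, mul_zero, nonpos_iff_eq_zero, setLIntegral_eq_zero_iff measurableSet_Ioo
      (measurable_maxOn _ _ _)]
    refine Filter.Eventually.of_forall fun x _ => ?_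
    by_contra hx
    obtain ⟨s, t, -, hs, ht, h⟩ := lt_maxOn_iff.1 (pos_iff_ne_zero.2 hx)
    rw [zero_mul] at h
    exact h.ne' (measure_mono_null (Ioo_subset_Ioo hs ht) hμ0)
  have hhalf : ∀ k : ℕ, 2 * μ (superlevel μ a b (2 ^ (k + N) * l)) ≤
      μ (superlevel μ a b (2 ^ k * l)) := by
    intro k
    set W := superlevel μ a b (2 ^ (k + N) * l) with hW
    have hWU : W ⊆ superlevel μ a b (2 ^ k * l) := by
      refine superlevel_anti _ _ _ ?_
      gcongr
      · exact one_le_two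
      · omega
    -- The hypothesis is applied on each component of the lower superlevel set. There the weak-type
    -- bound and the mean of the component give `2^N |W ∩ I| ≤ 2|I|`.
    have h1 := measure_superlevel_eq_tsum (μ.restrict W) μ a b (2 ^ k * l)
    rw [Measure.restrict_apply (isOpen_superlevel _ _ _ _).measurableSet,
      inter_eq_self_of_subset_right hWU] at h1
    rw [h1, measure_superlevel_eq_tsum, ← ENNReal.tsum_mul_left]
    refine ENNReal.tsum_le_tsum fun I => ?_
    obtain ⟨I, hI⟩ := I
    rw [Measure.restrict_apply measurableSet_Ioo, inter_comm, hW, superlevel_inter_component hI]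
    refine H _ _ hI.1 _ (superlevel_subset _ _ _ _) (isOpen_superlevel _ _ _ _) ?_
    have hc0 : 2 ^ k * l ≠ 0 := mul_ne_zero (by positivity) hl0
    have hct : 2 ^ k * l ≠ ∞ := ENNReal.mul_ne_top (by finiteness) hlt
    rw [← ENNReal.mul_le_mul_iff_right hc0 hct]
    calc 2 ^ k * l * (2 ^ N * volume (superlevel μ I.1 I.2 (2 ^ (k + N) * l)))
        = 2 ^ (k + N) * l * volume (superlevel μ I.1 I.2 (2 ^ (k + N) * l)) := by
          rw [pow_add]; ring
      _ ≤ 2 * μ (superlevel μ I.1 I.2 (2 ^ (k + N) * l)) := mul_volume_superlevel_le _ _ _ _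
      _ ≤ 2 * μ (Ioo I.1 I.2) := by
          gcongr
          exact superlevel_subset _ _ _ _
      _ ≤ 2 * (2 ^ k * l * volume (Ioo I.1 I.2)) := by
          gcongr
          exact measure_component_le (hlv.symm.le.trans (mul_le_mul_left (hmono k) _)) hI
      _ = _ := by ring
  have hsum := tsum_le_of_halving (hfin a b) (fun k => measure_mono (superlevel_subset μ a b _)) hhalf
  calc ∫⁻ x in Ioo a b, maxOn μ a b x
      ≤ ∫⁻ x in Ioo a b, (l + ∑' k : ℕ,
          if 2 ^ k * l < maxOn μ a b x then 2 ^ k * l else 0) :=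
        lintegral_mono fun x => le_add_tsum_two_pow hl0
    _ ≤ l * volume (Ioo a b) + ∫⁻ x, ∑' k : ℕ,
          if 2 ^ k * l < maxOn μ a b x then 2 ^ k * l else 0 := by
        rw [lintegral_add_left measurable_const, setLIntegral_const]
        exact add_le_add_right (setLIntegral_le_lintegral _ _) _
    _ = μ (Ioo a b) + ∑' k : ℕ, 2 ^ k * l * volume (superlevel μ a b (2 ^ k * l)) := by
        rw [hlv, lintegral_tsum fun k => (Measurable.ite
          (isOpen_superlevel _ _ _ _).measurableSet measurable_const
            measurable_const).aemeasurable]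
        congr 1
        refine tsum_congr fun k => ?_
        rw [← setLIntegral_const, ← lintegral_indicator (isOpen_superlevel _ _ _ _).measurableSet]
        classical
        simp only [indicator_apply, mem_superlevel]
    _ ≤ μ (Ioo a b) + ∑' k : ℕ, 2 * μ (superlevel μ a b (2 ^ k * l)) := by
        exact add_le_add_right (ENNReal.tsum_le_tsum fun k => mul_volume_superlevel_le _ _ _ _) _
    _ ≤ μ (Ioo a b) + 2 * (2 * N * μ (Ioo a b)) := by
        rw [ENNReal.tsum_mul_left]
        gcongr
    _ = _ := by ring

/-! ### The Fujii-Wilson constant of a density -/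

/-- Cutting an averaging interval down to `(a, b)` keeps the integral and does not increase the
length. -/
lemma hlMaximal_indicator_eq_maxOn (f : ℝ → ℝ≥0∞) {a b x : ℝ} (hx : x ∈ Ioo a b) :
    hlMaximal ((Ioo a b).indicator f) x = maxOn (volume.withDensity f) a b x := by
  have hint : ∀ s t : ℝ, ∫⁻ u in Ioo s t, (Ioo a b).indicator f u
      = volume.withDensity f (Ioo (max a s) (min b t)) := by
    intro s t
    rw [setLIntegral_indicator measurableSet_Ioo, Ioo_inter_Ioo,
      withDensity_apply _ measurableSet_Ioo]
  refine le_antisymm ?_ ?_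
  · refine iSup_le fun s => iSup_le fun t => iSup_le fun hst => ?_
    rw [hint]
    have hmem : x ∈ Ioo (max a s) (min b t) :=
      ⟨max_lt hx.1 hst.1, lt_min hx.2 hst.2⟩
    refine le_trans ?_ (le_iSup_of_le (max a s) <| le_iSup_of_le (min b t) <|
      le_iSup_of_le hmem <| le_iSup_of_le (le_max_left _ _) <|
      le_iSup_of_le (min_le_left _ _) le_rfl)
    gcongr
    · exact le_max_right _ _
    · exact min_le_right _ _
  · refine iSup_le fun s => iSup_le fun t => iSup_le fun hst => iSup_le fun hs => iSup_le fun ht => ?_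
    refine le_iSup_of_le s <| le_iSup_of_le t <| le_iSup_of_le hst ?_
    rw [hint, max_eq_right hs, min_eq_right ht]

/-- The values `0` and `∞` of `A` are excluded because quotients by `∞` and by `0` do not match the
multiplied-out inequality there. -/
lemma fujiiWilson_le_iff {v : ℝ → ℝ} {A : ℝ≥0∞} (hA0 : A ≠ 0) (hA : A ≠ ∞) :
    fujiiWilson v ≤ A ↔ FujiiWilsonLE (volume.withDensity fun u => ENNReal.ofReal (v u)) A := by
  simp only [fujiiWilson, FujiiWilsonLE, iSup_le_iff]
  refine forall_congr' fun a => forall_congr' fun b => forall_congr' fun _ => ?_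
  rw [ENNReal.div_le_iff_le_mul (Or.inr hA) (Or.inr hA0), withDensity_apply _ measurableSet_Ioo,
    setLIntegral_congr_fun measurableSet_Ioo fun x hx => hlMaximal_indicator_eq_maxOn _ hx]

/-- The localized maximal function is at least the mean, so any interval of positive mass forces `A
≥ 1`. This isolates the degenerate weights. -/
lemma FujiiWilsonLE.eq_zero {μ : Measure ℝ} {A : ℝ≥0∞} (hA1 : A < 1) (hA : FujiiWilsonLE μ A)
    (hfin : ∀ a b, μ (Ioo a b) ≠ ∞) : μ = 0 := by
  have hI : ∀ a b, a < b → μ (Ioo a b) = 0 := by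
    intro a b hab
    by_contra h0
    have hv0 : volume (Ioo a b) ≠ 0 := by simpa using hab
    have hvt : volume (Ioo a b) ≠ ∞ := by simp
    have h1 : μ (Ioo a b) ≤ ∫⁻ x in Ioo a b, maxOn μ a b x := by
      calc μ (Ioo a b) = ∫⁻ _ in Ioo a b, μ (Ioo a b) / volume (Ioo a b) := by
            rw [setLIntegral_const, ENNReal.div_mul_cancel hv0 hvt]
        _ ≤ _ := setLIntegral_mono (measurable_maxOn _ _ _) fun x hx =>
            le_iSup_of_le a <| le_iSup_of_le b <| le_iSup_of_le hx <| le_iSup_of_le le_rfl <|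
              le_iSup_of_le le_rfl le_rfl
    have h2 := h1.trans (hA a b hab)
    have h3 := ENNReal.mul_lt_mul_left h0 (hfin a b) hA1
    rw [one_mul] at h3
    exact absurd h2 (not_le.2 h3)
  rw [← Measure.measure_univ_eq_zero]
  have : (univ : Set ℝ) = ⋃ n : ℕ, Ioo (-(n + 1 : ℝ)) (n + 1) := by
    refine (eq_univ_of_forall fun x => ?_).symm
    obtain ⟨n, hn⟩ := exists_nat_gt |x|
    exact mem_iUnion.2 ⟨n, by constructor <;> linarith [abs_lt.1 hn]⟩
  rw [this]
  exact measure_iUnion_null fun n => hI _ _ (by have : (0 : ℝ) ≤ n := n.cast_nonneg; linarith)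

/-! ### Slicing along a coordinate direction -/

variable {d : ℕ}

/-- The measure on the line whose density is a one-dimensional section of `w`. -/
noncomputable def sectionMeasure (w : (Fin (d + 1) → ℝ) → ℝ) (j : Fin (d + 1)) (y : Fin d → ℝ) :
    Measure ℝ :=
  volume.withDensity fun t => ENNReal.ofReal (lineSection w j y t)

lemma sectionMeasure_absolutelyContinuous (w : (Fin (d + 1) → ℝ) → ℝ) (j : Fin (d + 1))
    (y : Fin d → ℝ) : sectionMeasure w j y ≪ volume :=
  withDensity_absolutelyContinuous _ _

lemma measurable_insertNth (j : Fin (d + 1)) :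
    Measurable fun p : ℝ × (Fin d → ℝ) => (j.insertNth p.1 p.2 : Fin (d + 1) → ℝ) :=
  (MeasurableEquiv.piFinSuccAbove (fun _ => ℝ) j).symm.measurable

lemma measurePreserving_insertNth (j : Fin (d + 1)) :
    MeasurePreserving fun p : ℝ × (Fin d → ℝ) => (j.insertNth p.1 p.2 : Fin (d + 1) → ℝ) :=
  (volume_preserving_piFinSuccAbove (fun _ => ℝ) j).symm

lemma lintegral_eq_lintegral_insertNth (j : Fin (d + 1)) {f : (Fin (d + 1) → ℝ) → ℝ≥0∞}
    (hf : AEMeasurable f) :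
    ∫⁻ x, f x = ∫⁻ y : Fin d → ℝ, ∫⁻ t, f (j.insertNth t y) := by
  rw [← (measurePreserving_insertNth j).lintegral_comp_emb
    (MeasurableEquiv.piFinSuccAbove (fun _ => ℝ) j).symm.measurableEmbedding f,
    Measure.volume_eq_prod]
  exact lintegral_prod_symm _ (hf.comp_quasiMeasurePreserving (measurePreserving_insertNth j).quasiMeasurePreserving)

lemma aemeasurable_lintegral_insertNth (j : Fin (d + 1)) {f : (Fin (d + 1) → ℝ) → ℝ≥0∞}
    (hf : AEMeasurable f) : AEMeasurable fun y : Fin d → ℝ => ∫⁻ t, f (j.insertNth t y) :=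
  AEMeasurable.lintegral_prod_left' (hf.comp_quasiMeasurePreserving (measurePreserving_insertNth j).quasiMeasurePreserving)

lemma IsWeight.aemeasurable {w : (Fin (d + 1) → ℝ) → ℝ} (hw : IsWeight w) :
    AEMeasurable fun x => ENNReal.ofReal (w x) :=
  hw.locallyIntegrable.aestronglyMeasurable.aemeasurable.ennreal_ofReal

lemma measurableSet_section (j : Fin (d + 1)) {S : Set (Fin (d + 1) → ℝ)} (hS : MeasurableSet S)
    (y : Fin d → ℝ) : MeasurableSet {t : ℝ | (j.insertNth t y : Fin (d + 1) → ℝ) ∈ S} :=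
  (measurable_insertNth j).comp (measurable_id.prodMk measurable_const) hS

lemma sectionMeasure_eq_lintegral (w : (Fin (d + 1) → ℝ) → ℝ) (j : Fin (d + 1))
    {S : Set (Fin (d + 1) → ℝ)} (hS : MeasurableSet S) (y : Fin d → ℝ) :
    sectionMeasure w j y {t | (j.insertNth t y : Fin (d + 1) → ℝ) ∈ S}
      = ∫⁻ t, S.indicator (fun x => ENNReal.ofReal (w x)) (j.insertNth t y) := by
  rw [sectionMeasure, withDensity_apply _ (measurableSet_section j hS y),
    ← lintegral_indicator (measurableSet_section j hS y)]
  rfl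

lemma weightMeasure_eq_lintegral {w : (Fin (d + 1) → ℝ) → ℝ} (hw : IsWeight w)
    (j : Fin (d + 1)) {S : Set (Fin (d + 1) → ℝ)} (hS : MeasurableSet S) :
    weightMeasure w S
      = ∫⁻ y, sectionMeasure w j y {t | (j.insertNth t y : Fin (d + 1) → ℝ) ∈ S} := by
  rw [weightMeasure, withDensity_apply _ hS, ← lintegral_indicator hS,
    lintegral_eq_lintegral_insertNth j (hw.aemeasurable.indicator hS)]
  exact lintegral_congr fun y => (sectionMeasure_eq_lintegral w j hS y).symm

lemma aemeasurable_sectionMeasure {w : (Fin (d + 1) → ℝ) → ℝ} (hw : IsWeight w)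
    (j : Fin (d + 1)) {S : Set (Fin (d + 1) → ℝ)} (hS : MeasurableSet S) :
    AEMeasurable fun y : Fin d → ℝ =>
      sectionMeasure w j y {t | (j.insertNth t y : Fin (d + 1) → ℝ) ∈ S} := by
  simp only [sectionMeasure_eq_lintegral w j hS]
  exact aemeasurable_lintegral_insertNth j (hw.aemeasurable.indicator hS)

lemma volume_eq_lintegral (j : Fin (d + 1)) {S : Set (Fin (d + 1) → ℝ)} (hS : MeasurableSet S) :
    volume S = ∫⁻ y : Fin d → ℝ, volume {t : ℝ | (j.insertNth t y : Fin (d + 1) → ℝ) ∈ S} := by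
  rw [← lintegral_indicator_one hS,
    lintegral_eq_lintegral_insertNth j (f := S.indicator 1)
      (measurable_one.indicator hS).aemeasurable]
  refine lintegral_congr fun y => ?_
  rw [← lintegral_indicator_one (measurableSet_section j hS y)]
  rfl

lemma IsWeight.weightMeasure_lt_top {w : (Fin (d + 1) → ℝ) → ℝ} (hw : IsWeight w)
    {K : Set (Fin (d + 1) → ℝ)} (hK : IsCompact K) : weightMeasure w K < ∞ := by
  rw [weightMeasure, withDensity_apply _ hK.measurableSet]
  exact (hw.locallyIntegrable.integrableOn_isCompact hK).lintegral_lt_top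

lemma norm_insertNth_le {j : Fin (d + 1)} {t : ℝ} {y : Fin d → ℝ} {r : ℝ} (ht : |t| ≤ r)
    (hy : ‖y‖ ≤ r) : ‖(j.insertNth t y : Fin (d + 1) → ℝ)‖ ≤ r := by
  refine (pi_norm_le_iff_of_nonneg ((abs_nonneg t).trans ht)).2 fun i => ?_
  rcases Fin.eq_self_or_eq_succAbove j i with rfl | ⟨k, rfl⟩
  · simpa using ht
  · simpa using (norm_le_pi_norm y k).trans hy

lemma IsWeight.ae_sectionMeasure_ne_top {w : (Fin (d + 1) → ℝ) → ℝ} (hw : IsWeight w)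
    (j : Fin (d + 1)) : ∀ᵐ y : Fin d → ℝ, ∀ a b, sectionMeasure w j y (Ioo a b) ≠ ∞ := by
  have h : ∀ n : ℕ, ∀ᵐ y : Fin d → ℝ, sectionMeasure w j y
      {t | (j.insertNth t y : Fin (d + 1) → ℝ) ∈ Metric.closedBall 0 (n : ℝ)} < ∞ := by
    intro n
    refine ae_lt_top' (aemeasurable_sectionMeasure hw j measurableSet_closedBall) ?_
    rw [← weightMeasure_eq_lintegral hw j measurableSet_closedBall]
    exact (hw.weightMeasure_lt_top (isCompact_closedBall _ _)).ne
  filter_upwards [ae_all_iff.2 h] with y hy a b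
  obtain ⟨n, hn⟩ := exists_nat_ge (max ‖y‖ (max |a| |b|))
  simp only [max_le_iff] at hn
  refine ((measure_mono fun t ht => ?_).trans_lt (hy n)).ne
  have hta := abs_le.1 hn.2.1
  have htb := abs_le.1 hn.2.2
  exact mem_closedBall_zero_iff.2 (norm_insertNth_le
    (abs_le.2 ⟨by linarith [ht.1], by linarith [ht.2]⟩) hn.1)

lemma ae_fujiiWilson_le (w : (Fin (d + 1) → ℝ) → ℝ) (j : Fin (d + 1)) :
    ∀ᵐ y, fujiiWilson (lineSection w j y) ≤ strongAInftyConst w := by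
  filter_upwards [ENNReal.ae_le_essSup fun y => fujiiWilson (lineSection w j y)] with y hy
  exact hy.trans (le_iSup (fun j => essSup (fun y => fujiiWilson (lineSection w j y)) volume) j)

lemma IsWeight.weightMeasure_eq_zero {w : (Fin (d + 1) → ℝ) → ℝ} (hw : IsWeight w)
    (h : strongAInftyConst w < 1) : weightMeasure w = 0 := by
  rw [← Measure.measure_univ_eq_zero, weightMeasure_eq_lintegral hw 0 MeasurableSet.univ,
    lintegral_eq_zero_iff' (aemeasurable_sectionMeasure hw 0 MeasurableSet.univ)]
  filter_upwards [hw.ae_sectionMeasure_ne_top 0, ae_fujiiWilson_le w 0] with y hfin hy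
  have hA1 : max (strongAInftyConst w) 2⁻¹ < 1 := max_lt h ENNReal.one_half_lt_one
  have hFW := (fujiiWilson_le_iff (by simp) (hA1.trans ENNReal.one_lt_top).ne).1
    (hy.trans (le_max_left _ 2⁻¹))
  have : sectionMeasure w 0 y = 0 := hFW.eq_zero hA1 hfin
  simp [this]

/-! ### Enlarging a set one direction at a time -/

/-- The strict inequality leaves room to shrink to rational endpoints, so that `directional` can be
a countable union and hence measurable. -/
lemma exists_rat_Ioo_of_lt {a b x : ℝ} (hx : x ∈ Ioo a b) {m c : ℝ≥0∞} (hc : c ≠ ∞)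
    (hm : m < c * volume (Ioo a b)) :
    ∃ p q : ℚ, x ∈ Ioo (p : ℝ) q ∧ a ≤ p ∧ q ≤ b ∧ m ≤ c * volume (Ioo (p : ℝ) q) := by
  have hlim : Filter.Tendsto (fun r : ℝ => c * ENNReal.ofReal (b - a - 2 * r))
      (nhdsWithin 0 (Ioi 0)) (nhds (c * ENNReal.ofReal (b - a))) := by
    refine ENNReal.Tendsto.const_mul ?_ (Or.inr hc)
    have : Continuous fun r : ℝ => ENNReal.ofReal (b - a - 2 * r) :=
      ENNReal.continuous_ofReal.comp (by fun_prop)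
    simpa using (this.tendsto 0).mono_left nhdsWithin_le_nhds
  rw [Real.volume_Ioo] at hm
  obtain ⟨r, hr, hr0, hrx⟩ := ((hlim.eventually (lt_mem_nhds hm)).and
    (Ioo_mem_nhdsGT (show 0 < min (x - a) (b - x) from
      lt_min (by linarith [hx.1]) (by linarith [hx.2])))).exists
  have hrx := lt_min_iff.1 hrx
  obtain ⟨p, hp1, hp2⟩ := exists_rat_btwn (show a < a + r by linarith)
  obtain ⟨q, hq1, hq2⟩ := exists_rat_btwn (show b - r < b by linarith)
  refine ⟨p, q, ⟨by linarith, by linarith⟩, hp1.le, hq2.le, hr.le.trans ?_⟩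
  rw [Real.volume_Ioo]
  refine mul_le_mul_right (ENNReal.ofReal_le_ofReal ?_) _
  linarith

/-- The points through which some interval in direction `j` with rational endpoints meets the
complement of `F` in a proportion at most `η`. -/
def directional (j : Fin (d + 1)) (η : ℝ) (F : Set (Fin (d + 1) → ℝ)) : Set (Fin (d + 1) → ℝ) :=
  {x | ∃ p q : ℚ, x j ∈ Ioo (p : ℝ) q ∧
    volume (Ioo (p : ℝ) q \ {u | Function.update x j u ∈ F})
      ≤ ENNReal.ofReal η * volume (Ioo (p : ℝ) q)}

lemma measurable_volume_update (j : Fin (d + 1)) {I : Set ℝ} (hI : MeasurableSet I)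
    {F : Set (Fin (d + 1) → ℝ)} (hF : MeasurableSet F) :
    Measurable fun x : Fin (d + 1) → ℝ => volume (I ∩ {u | Function.update x j u ∈ F}) := by
  have hS : MeasurableSet {p : (Fin (d + 1) → ℝ) × ℝ | p.2 ∈ I ∧ Function.update p.1 j p.2 ∈ F} :=
    (measurable_snd hI).inter (measurable_update' hF)
  exact measurable_measure_prodMk_left hS

lemma measurableSet_directional (j : Fin (d + 1)) (η : ℝ) {F : Set (Fin (d + 1) → ℝ)}
    (hF : MeasurableSet F) : MeasurableSet (directional j η F) := by
  have : directional j η F = ⋃ p : ℚ, ⋃ q : ℚ, {x | x j ∈ Ioo (p : ℝ) q} ∩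
      {x | volume (Ioo (p : ℝ) q ∩ {u | Function.update x j u ∈ Fᶜ})
        ≤ ENNReal.ofReal η * volume (Ioo (p : ℝ) q)} := by
    ext x
    simp only [directional, mem_ofPred_eq, mem_iUnion, mem_inter_iff]
    rfl
  rw [this]
  refine MeasurableSet.iUnion fun p => MeasurableSet.iUnion fun q => ?_
  exact (measurable_pi_apply j measurableSet_Ioo).inter
    (measurableSet_le (measurable_volume_update j measurableSet_Ioo hF.compl) measurable_const)

lemma weightMeasure_directional_le {w : (Fin (d + 1) → ℝ) → ℝ} (hw : IsWeight w) {A : ℝ}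
    (hA1 : 1 ≤ A) (hA : strongAInftyConst w ≤ ENNReal.ofReal A) (j : Fin (d + 1)) {η : ℝ}
    (hη : 0 < η) (hη1 : η ≤ 1) (hsmall : 16 * η ^ (1 / (6 * A)) ≤ 1)
    {F : Set (Fin (d + 1) → ℝ)} (hF : MeasurableSet F) :
    weightMeasure w (directional j η F)
      ≤ ENNReal.ofReal (1 + 16 * η ^ (1 / (6 * A))) * weightMeasure w F := by
  rw [weightMeasure_eq_lintegral hw j hF,
    weightMeasure_eq_lintegral hw j (measurableSet_directional j η hF),
    ← lintegral_const_mul'' _ (aemeasurable_sectionMeasure hw j hF)]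
  refine lintegral_mono_ae ?_
  filter_upwards [hw.ae_sectionMeasure_ne_top j, ae_fujiiWilson_le w j] with y hfin hy
  have hFW : FujiiWilsonLE (sectionMeasure w j y) (ENNReal.ofReal A) :=
    (fujiiWilson_le_iff (by simpa using by linarith) ENNReal.ofReal_ne_top).1 (hy.trans hA)
  refine le_trans (measure_mono ?_) (hFW.tauberian_line hA1
    (sectionMeasure_absolutelyContinuous w j y) hfin hη hη1 hsmall
    (F := {t | (j.insertNth t y : Fin (d + 1) → ℝ) ∈ F})
    (T := {I | I.1 < I.2 ∧ volume (Ioo I.1 I.2 \ {t | (j.insertNth t y : Fin (d + 1) → ℝ) ∈ F})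
      ≤ ENNReal.ofReal η * volume (Ioo I.1 I.2)}) fun I hI => hI)
  rintro t ⟨p, q, ht, hpq⟩
  simp only [Fin.insertNth_apply_same, Fin.update_insertNth] at ht hpq
  exact mem_biUnion (x := ((p : ℝ), (q : ℝ))) ⟨ht.1.trans ht.2, hpq⟩ ht

lemma measurableSet_rect {n : ℕ} (a b : Fin n → ℝ) : MeasurableSet (rect a b) :=
  MeasurableSet.univ_pi fun _ => measurableSet_Ioo

lemma update_mem_rect {n : ℕ} {a b x : Fin n → ℝ} (hx : x ∈ rect a b) {j : Fin n} {u : ℝ}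
    (hu : u ∈ Ioo (a j) (b j)) : Function.update x j u ∈ rect a b := by
  intro i _
  by_cases h : i = j
  · subst h
    simpa using hu
  · simpa [h] using hx i (mem_univ i)

/-- A Chebyshev inequality on fibres: the set of points whose fibre meets `B` in proportion at least
`c` does not depend on the coordinate `j`, so on each line it contains the whole fibre of the
rectangle or none of it. -/
lemma mul_volume_rect_inter_le (j : Fin (d + 1)) (c : ℝ≥0∞) (a b : Fin (d + 1) → ℝ)
    {B : Set (Fin (d + 1) → ℝ)} (hB : MeasurableSet B) :
    c * volume (rect a b ∩ {x | c * volume (Ioo (a j) (b j)) ≤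
      volume (Ioo (a j) (b j) ∩ {u | Function.update x j u ∈ B})}) ≤ volume (rect a b ∩ B) := by
  have hB' : MeasurableSet {x : Fin (d + 1) → ℝ | c * volume (Ioo (a j) (b j)) ≤
      volume (Ioo (a j) (b j) ∩ {u | Function.update x j u ∈ B})} :=
    measurableSet_le measurable_const (measurable_volume_update j measurableSet_Ioo hB)
  set B' := {x : Fin (d + 1) → ℝ | c * volume (Ioo (a j) (b j)) ≤
      volume (Ioo (a j) (b j) ∩ {u | Function.update x j u ∈ B})} with hB'def
  have hR := measurableSet_rect a b
  rw [volume_eq_lintegral j (hR.inter hB), volume_eq_lintegral j (hR.inter hB')]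
  refine (lintegral_const_mul_le _ _).trans (lintegral_mono fun y => ?_)
  rcases eq_empty_or_nonempty {t : ℝ | (j.insertNth t y : Fin (d + 1) → ℝ) ∈ rect a b ∩ B'}
    with h | ⟨t, htR, htB⟩
  · rw [h]
    simp
  · rw [hB'def, mem_ofPred_eq] at htB
    simp only [Fin.update_insertNth] at htB
    calc c * volume {t : ℝ | (j.insertNth t y : Fin (d + 1) → ℝ) ∈ rect a b ∩ B'}
        ≤ c * volume (Ioo (a j) (b j)) := by
          gcongr
          intro u hu
          simpa using hu.1 j (mem_univ j)
      _ ≤ _ := htB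
      _ ≤ _ := by
          refine measure_mono fun u hu => ⟨?_, hu.2⟩
          simpa using update_mem_rect htR hu.1

/-- The set `B` is the induction invariant. It controls what a rectangle has outside `F`, each
treated direction removes one coordinate from its dependence, and its volume is lost by at most a
factor `η` per direction. -/
lemma exists_enlargement {w : (Fin (d + 1) → ℝ) → ℝ} (hw : IsWeight w) {A : ℝ}
    (hA1 : 1 ≤ A) (hA : strongAInftyConst w ≤ ENNReal.ofReal A) {η : ℝ}
    (hη : 0 < η) (hη1 : η ≤ 1) (hsmall : 16 * η ^ (1 / (6 * A)) ≤ 1)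
    {E : Set (Fin (d + 1) → ℝ)} (hE : MeasurableSet E) (s : Finset (Fin (d + 1))) :
    ∃ F, MeasurableSet F ∧
      weightMeasure w F ≤ ENNReal.ofReal (1 + 16 * η ^ (1 / (6 * A))) ^ s.card * weightMeasure w E ∧
      ∀ a b, ∃ B, MeasurableSet B ∧ rect a b \ F ⊆ B ∧
        DependsOn (fun x => x ∈ B) (↑s : Set (Fin (d + 1)))ᶜ ∧
        ENNReal.ofReal η ^ s.card * volume (rect a b ∩ B) ≤ volume (rect a b \ E) := by
  induction s using Finset.induction_on with
  | empty =>
    refine ⟨E, hE, by simp, fun a b => ⟨Eᶜ, hE.compl, fun x hx => hx.2, ?_, ?_⟩⟩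
    · simpa using dependsOn_univ _
    · simp [sdiff_eq]
  | insert j s hj ih =>
    obtain ⟨F, hF, hwF, h⟩ := ih
    refine ⟨directional j η F, measurableSet_directional j η hF, ?_, fun a b => ?_⟩
    · refine (weightMeasure_directional_le hw hA1 hA j hη hη1 hsmall hF).trans ?_
      rw [Finset.card_insert_of_notMem hj, pow_succ', mul_assoc]
      gcongr
    · obtain ⟨B, hB, hFB, hdep, hvol⟩ := h a b
      refine ⟨{x | ENNReal.ofReal η * volume (Ioo (a j) (b j)) ≤
        volume (Ioo (a j) (b j) ∩ {u | Function.update x j u ∈ B})},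
        measurableSet_le measurable_const (measurable_volume_update j measurableSet_Ioo hB),
        ?_, ?_, ?_⟩
      · rintro x ⟨hxR, hxF⟩
        by_contra hx
        -- If `B` fills less than the fraction `η` of the fibre through `x`, so does the complement
        -- of `F`, and `x` belongs to the enlargement.
        obtain ⟨p, q, hpq, hap, hqb, hle⟩ := exists_rat_Ioo_of_lt (hxR j (mem_univ j))
          ENNReal.ofReal_ne_top (not_le.1 hx)
        refine hxF ⟨p, q, hpq, (measure_mono fun u hu => ?_).trans hle⟩
        have huab : u ∈ Ioo (a j) (b j) := Ioo_subset_Ioo hap hqb hu.1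
        exact ⟨huab, hFB ⟨update_mem_rect hxR huab, hu.2⟩⟩
      · intro x y hxy
        have hu : ∀ u, (Function.update x j u ∈ B) = (Function.update y j u ∈ B) := by
          intro u
          refine hdep fun i hi => ?_
          by_cases hij : i = j
          · subst hij
            simp
          · simpa [hij] using hxy i (by simpa [hij] using hi)
        simp only [mem_ofPred_eq, hu]
      · rw [Finset.card_insert_of_notMem hj, pow_succ, mul_assoc]
        exact le_trans (by gcongr; exact mul_volume_rect_inter_le j _ a b hB) hvol

lemma superlevel_strongMaximal_iff {n : ℕ} {E : Set (Fin n → ℝ)} (hE : MeasurableSet E)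
    {c : ℝ≥0∞} {x : Fin n → ℝ} : c < strongMaximal (E.indicator fun _ => 1) x ↔
      ∃ a b, x ∈ rect a b ∧ c < volume (E ∩ rect a b) / volume (rect a b) := by
  simp only [strongMaximal, lt_iSup_iff, exists_prop]
  simp [lintegral_indicator_const hE, Measure.restrict_apply hE]

lemma volume_rect_ne_top {n : ℕ} (a b : Fin n → ℝ) : volume (rect a b) ≠ ∞ := by
  rw [rect, Real.volume_pi_Ioo]
  exact ENNReal.prod_ne_top fun _ _ => ENNReal.ofReal_ne_top

lemma volume_rect_pos {n : ℕ} {a b x : Fin n → ℝ} (hx : x ∈ rect a b) : volume (rect a b) ≠ 0 := by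
  rw [rect, Real.volume_pi_Ioo]
  exact Finset.prod_ne_zero_iff.2 fun i _ => by
    simpa using (hx i (mem_univ i)).1.trans (hx i (mem_univ i)).2

lemma volume_rect_sdiff_lt {n : ℕ} {a b x : Fin n → ℝ} (hx : x ∈ rect a b) {E : Set (Fin n → ℝ)}
    (hE : MeasurableSet E) {α : ℝ} (hα : 0 ≤ α) (hα1 : α ≤ 1)
    (h : ENNReal.ofReal α < volume (E ∩ rect a b) / volume (rect a b)) :
    volume (rect a b \ E) < ENNReal.ofReal (1 - α) * volume (rect a b) := by
  have h0 := volume_rect_pos hx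
  have ht := volume_rect_ne_top a b
  rw [ENNReal.lt_div_iff_mul_lt (Or.inl h0) (Or.inl ht), inter_comm] at h
  have hsum := measure_inter_add_sdiff (μ := volume) (rect a b) hE
  have hone : ENNReal.ofReal (1 - α) + ENNReal.ofReal α = 1 := by
    rw [← ENNReal.ofReal_add (by linarith) hα]; simp
  by_contra! hcon
  have : volume (rect a b) < volume (rect a b) := by
    calc volume (rect a b)
        = ENNReal.ofReal α * volume (rect a b) + ENNReal.ofReal (1 - α) * volume (rect a b) := by
          rw [← add_mul, add_comm, hone, one_mul]
      _ < volume (rect a b ∩ E) + volume (rect a b \ E) :=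
          ENNReal.add_lt_add_of_lt_of_le (ENNReal.mul_ne_top ENNReal.ofReal_ne_top ht) h hcon
      _ = _ := hsum
  exact lt_irrefl _ this

/-- After all directions `B` depends on no coordinate. A point of a rectangle `R` outside `F` would
make `B` the whole space, so `|R \ E| ≥ η^n |R| ≥ (1 - α)|R|`, against a mean of `E` above `α`. -/
lemma tauberian_le {w : (Fin (d + 1) → ℝ) → ℝ} (hw : IsWeight w) {A : ℝ}
    (hA1 : 1 ≤ A) (hA : strongAInftyConst w ≤ ENNReal.ofReal A) {η : ℝ}
    (hη : 0 < η) (hη1 : η ≤ 1) (hsmall : 16 * η ^ (1 / (6 * A)) ≤ 1) {α : ℝ} (hα : 0 ≤ α)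
    (hα1 : α ≤ 1) (hαη : 1 - α ≤ η ^ (d + 1)) :
    tauberian w α ≤ ENNReal.ofReal (1 + 16 * η ^ (1 / (6 * A))) ^ (d + 1) := by
  refine iSup_le fun E => iSup_le fun hE => iSup_le fun h0 => iSup_le fun ht => ?_
  obtain ⟨F, hF, hwF, h⟩ := exists_enlargement hw hA1 hA hη hη1 hsmall hE Finset.univ
  refine ENNReal.div_le_of_le_mul ?_
  rw [Finset.card_univ, Fintype.card_fin] at hwF h
  refine (measure_mono fun x hx => ?_).trans hwF
  obtain ⟨a, b, hxR, hlt⟩ := (superlevel_strongMaximal_iff hE).1 hx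
  have hlt' := volume_rect_sdiff_lt hxR hE hα hα1 hlt
  obtain ⟨B, hB, hFB, hdep, hvol⟩ := h a b
  by_contra hxF
  have hxB := hFB ⟨hxR, hxF⟩
  have hBuniv : B = univ := by
    refine eq_univ_of_forall fun y => ?_
    rw [Finset.coe_univ, compl_univ] at hdep
    exact (hdep.empty x y).mp hxB
  rw [hBuniv, inter_univ, ← ENNReal.ofReal_pow hη.le] at hvol
  refine absurd (hlt'.trans_le ?_) (not_lt.2 hvol)
  gcongr

lemma one_add_pow_le (n : ℕ) {θ : ℝ} (h0 : 0 ≤ θ) (h1 : θ ≤ 1) :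
    (1 + 16 * θ) ^ n ≤ 1 + 17 ^ n * θ := by
  -- The chord of the convex left side over `[0, 1]`; this sharper form is the one that passes
  -- through the induction.
  suffices h : (1 + 16 * θ) ^ n ≤ 1 + (17 ^ n - 1) * θ by linarith
  induction n with
  | zero => simp
  | succ n ih =>
    have h17 : (1 : ℝ) ≤ 17 ^ n := one_le_pow₀ (by norm_num)
    calc (1 + 16 * θ) ^ (n + 1) ≤ (1 + (17 ^ n - 1) * θ) * (1 + 16 * θ) := by
          rw [pow_succ]
          gcongr
      _ ≤ _ := by
          rw [pow_succ]
          nlinarith [mul_nonneg (mul_nonneg h0 (sub_nonneg.2 h1)) (sub_nonneg.2 h17)]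

lemma tauberian_eq_zero {n : ℕ} {w : (Fin n → ℝ) → ℝ} (hw : weightMeasure w = 0) (α : ℝ) :
    tauberian w α = 0 := by
  simp [tauberian, hw]

lemma StrongAInfty.solyanikEstimate {w : (Fin (d + 1) → ℝ) → ℝ} (hw : StrongAInfty w) :
    SolyanikEstimate w (17 ^ (d + 1)) (18 * ((d + 1 : ℕ) : ℝ) * (strongAInftyConst w).toReal)
      (18 * ((d + 1 : ℕ) : ℝ) * (strongAInftyConst w).toReal) := by
  intro α hα hα1
  rcases lt_or_ge (strongAInftyConst w) 1 with h1 | h1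
  · rw [tauberian_eq_zero (hw.1.weightMeasure_eq_zero h1)]
    exact zero_le
  set A := (strongAInftyConst w).toReal with hAdef
  have hA : strongAInftyConst w ≤ ENNReal.ofReal A := (ENNReal.ofReal_toReal hw.2.ne).ge
  have hA1 : 1 ≤ A := by
    have := ENNReal.toReal_mono hw.2.ne h1
    simpa using this
  set n : ℝ := ((d + 1 : ℕ) : ℝ) with hn
  have hn0 : 0 < n := by rw [hn]; positivity
  have hA0 : 0 < A := by linarith
  set δ := 1 - α with hδdef
  have hδ0 : 0 < δ := by linarith
  have hδe : δ < Real.exp (-(18 * n * A)) := by linarith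
  have hδ1 : δ < 1 := hδe.trans (Real.exp_lt_one_iff.2 (by have := mul_pos hn0 hA0; linarith))
  set η := δ ^ (1 / n) with hη
  have hη0 : 0 < η := Real.rpow_pos_of_pos hδ0 _
  have hη1 : η ≤ 1 := Real.rpow_le_one hδ0.le hδ1.le (by positivity)
  have hθ : η ^ (1 / (6 * A)) = δ ^ (1 / (6 * n * A)) := by
    rw [hη, ← Real.rpow_mul hδ0.le]
    congr 1
    field_simp
  have hηn : η ^ (d + 1) = δ := by
    rw [hη, ← Real.rpow_natCast, ← Real.rpow_mul hδ0.le, ← hn, one_div,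
      inv_mul_cancel₀ hn0.ne', Real.rpow_one]
  have hθ0 : 0 < δ ^ (1 / (6 * n * A)) := Real.rpow_pos_of_pos hδ0 _
  have hsmall : 16 * η ^ (1 / (6 * A)) ≤ 1 := by
    rw [hθ]
    -- The constant is `18 = 6 · 3`: this range of `δ` makes the power at most `e^(-3) < 1/16`.
    -- Afterwards the exponent is weakened from `1/(6nA)` to `1/(18nA)`, so that one constant serves
    -- both places.
    have h3 : δ ^ (1 / (6 * n * A)) ≤ Real.exp (-3) := by
      refine (Real.rpow_le_rpow hδ0.le hδe.le (by positivity)).trans (le_of_eq ?_)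
      rw [← Real.exp_mul]
      congr 1
      field_simp
      norm_num
    have h16 : Real.exp (-3) ≤ 1 / 16 := by
      rw [Real.exp_neg, ← one_div]
      refine one_div_le_one_div_of_le (by norm_num) ?_
      have h2 : (2.7 : ℝ) ^ 3 ≤ Real.exp 1 ^ 3 := by
        gcongr
        linarith [Real.exp_one_gt_d9]
      rw [← Real.exp_nat_mul] at h2
      norm_num at h2
      linarith
    linarith
  have hα0 : 0 ≤ α := by linarith
  refine (tauberian_le hw.1 hA1 hA hη0 hη1 hsmall hα0 hα1.le hηn.ge).trans ?_
  rw [hθ] at hsmall ⊢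
  rw [← ENNReal.ofReal_pow (by positivity), ← ENNReal.ofReal_one,
    ← ENNReal.ofReal_add zero_le_one (by positivity)]
  refine ENNReal.ofReal_le_ofReal ((one_add_pow_le _ hθ0.le (by linarith)).trans ?_)
  gcongr 1 + 17 ^ (d + 1) * ?_
  refine Real.rpow_le_rpow_of_exponent_ge hδ0 hδ1.le ?_
  refine one_div_le_one_div_of_le (by positivity) ?_
  have := mul_pos hn0 hA0
  linarith

/-! ### From the Tauberian constant to the mass of small sets in rectangles -/

lemma weightMeasure_le_tauberian_mul {n : ℕ} {w : (Fin n → ℝ) → ℝ} {α : ℝ}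
    {E : Set (Fin n → ℝ)} (hE : MeasurableSet E) (h0 : weightMeasure w E ≠ 0)
    (ht : weightMeasure w E ≠ ∞) {a b : Fin n → ℝ}
    (h : ENNReal.ofReal α < volume (E ∩ rect a b) / volume (rect a b)) :
    weightMeasure w (rect a b) ≤ tauberian w α * weightMeasure w E := by
  have h1 : weightMeasure w {x | ENNReal.ofReal α < strongMaximal (E.indicator fun _ => 1) x} /
      weightMeasure w E ≤ tauberian w α :=
    le_iSup_of_le E <| le_iSup_of_le hE <| le_iSup_of_le (pos_iff_ne_zero.2 h0) <|
      le_iSup_of_le ht.lt_top le_rfl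
  rw [ENNReal.div_le_iff_le_mul (Or.inl h0) (Or.inl ht)] at h1
  exact (measure_mono fun x hx => (superlevel_strongMaximal_iff hE).2 ⟨a, b, hx, h⟩).trans h1

lemma IsWeight.weightMeasure_rect_ne_top {w : (Fin (d + 1) → ℝ) → ℝ} (hw : IsWeight w)
    (a b : Fin (d + 1) → ℝ) : weightMeasure w (rect a b) ≠ ∞ := by
  refine ((measure_mono ?_).trans_lt (hw.weightMeasure_lt_top (isCompact_Icc (a := a) (b := b)))).ne
  exact fun x hx => ⟨fun i => (hx i (mem_univ i)).1.le, fun i => (hx i (mem_univ i)).2.le⟩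

lemma ofReal_lt_volume_div {n : ℕ} {a b : Fin n → ℝ} {G E : Set (Fin n → ℝ)}
    (hG : MeasurableSet G) {δ : ℝ} (hδ0 : 0 < δ) (hδ1 : δ < 1)
    (hGδ : volume G < ENNReal.ofReal δ * volume (rect a b)) (hE : rect a b \ G ⊆ E) :
    ENNReal.ofReal (1 - δ) < volume (E ∩ rect a b) / volume (rect a b) := by
  have ht := volume_rect_ne_top a b
  have h0 : volume (rect a b) ≠ 0 := by
    rintro h
    simp [h] at hGδ
  rw [ENNReal.lt_div_iff_mul_lt (Or.inl h0) (Or.inl ht)]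
  have hsum := measure_inter_add_sdiff (μ := volume) (rect a b) hG
  have hone : ENNReal.ofReal (1 - δ) + ENNReal.ofReal δ = 1 := by
    rw [← ENNReal.ofReal_add (by linarith) hδ0.le]; simp
  by_contra! hcon
  have : volume (rect a b) < volume (rect a b) := by
    calc volume (rect a b) = volume (rect a b ∩ G) + volume (rect a b \ G) := hsum.symm
      _ ≤ volume G + volume (E ∩ rect a b) := by
          gcongr
          · exact inter_subset_right
          · exact fun x hx => ⟨hE hx, hx.1⟩
      _ < ENNReal.ofReal δ * volume (rect a b) + ENNReal.ofReal (1 - δ) * volume (rect a b) :=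
          ENNReal.add_lt_add_of_lt_of_le (hcon.trans_lt
            (ENNReal.mul_lt_top ENNReal.ofReal_lt_top ht.lt_top)).ne hGδ hcon
      _ = volume (rect a b) := by rw [← add_mul, add_comm, hone, one_mul]
  exact lt_irrefl _ this

/-- A Solyanik estimate forces small parts of a rectangle to carry at most half of its mass. -/
lemma two_mul_weightMeasure_le {w : (Fin (d + 1) → ℝ) → ℝ} (hw : IsWeight w) {δ : ℝ}
    (hδ0 : 0 < δ) (hδ1 : δ < 1) (hT : tauberian w (1 - δ) ≤ 1 + 2⁻¹) {a b : Fin (d + 1) → ℝ}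
    {G : Set (Fin (d + 1) → ℝ)} (hG : MeasurableSet G) (hGR : G ⊆ rect a b)
    (hGδ : volume G < ENNReal.ofReal δ * volume (rect a b)) :
    2 * weightMeasure w G ≤ weightMeasure w (rect a b) := by
  have hR := measurableSet_rect a b
  have hRt := hw.weightMeasure_rect_ne_top a b
  have key : ∀ E, MeasurableSet E → rect a b \ G ⊆ E → weightMeasure w E ≠ 0 →
      weightMeasure w E ≠ ∞ → weightMeasure w (rect a b) ≤ (1 + 2⁻¹) * weightMeasure w E :=
    fun E hE hsub h0 ht => (weightMeasure_le_tauberian_mul hE h0 ht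
      (ofReal_lt_volume_div hG hδ0 hδ1 hGδ hsub)).trans (by gcongr)
  -- A set of zero weight is not admissible in the supremum. In that case a small ball around a
  -- point of the support of `w` in the rectangle is added; its weight is positive but tends to
  -- zero, which forces the rectangle to have zero weight.
  by_cases h0 : weightMeasure w (rect a b \ G) = 0
  · suffices h : weightMeasure w (rect a b) = 0 by
      rw [measure_mono_null hGR h]
      simp
    by_contra hne
    obtain ⟨x, hxR, hx⟩ := exists_mem_forall_mem_nhdsWithin_pos_measure hne
    have hlim : Filter.Tendsto (fun r => (1 + 2⁻¹) * weightMeasure w (Metric.cthickening r {x}))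
        (nhdsWithin 0 (Ioi 0)) (nhds ((1 + 2⁻¹) * weightMeasure w (closure {x}))) := by
      refine ENNReal.Tendsto.const_mul ?_ (Or.inr (by finiteness))
      refine (tendsto_measure_cthickening ⟨1, one_pos, ?_⟩).mono_left nhdsWithin_le_nhds
      exact (hw.weightMeasure_lt_top isCompact_singleton.cthickening).ne
    have hnull : weightMeasure w {x} = 0 :=
      withDensity_absolutelyContinuous _ _ (measure_singleton x)
    rw [closure_singleton, hnull, mul_zero] at hlim
    refine hne (nonpos_iff_eq_zero.1 (ge_of_tendsto hlim ?_))
    filter_upwards [self_mem_nhdsWithin] with r hr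
    have hr : 0 < r := hr
    rw [Metric.cthickening_singleton _ hr.le]
    have hEle : weightMeasure w (rect a b \ G ∪ rect a b ∩ Metric.closedBall x r)
        ≤ weightMeasure w (Metric.closedBall x r) := by
      refine (measure_union_le _ _).trans ?_
      rw [h0, zero_add]
      exact measure_mono inter_subset_right
    have hpos : 0 < weightMeasure w (rect a b ∩ Metric.closedBall x r) :=
      hx _ (inter_mem_nhdsWithin _ (Metric.closedBall_mem_nhds x hr))
    refine (key (rect a b \ G ∪ rect a b ∩ Metric.closedBall x r)
      ((hR.diff hG).union (hR.inter measurableSet_closedBall)) subset_union_left ?_ ?_).trans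
      (mul_le_mul_right hEle _)
    · exact (hpos.trans_le (measure_mono subset_union_right)).ne'
    · exact (hEle.trans_lt (hw.weightMeasure_lt_top (isCompact_closedBall _ _))).ne
  · have hEt : weightMeasure w (rect a b \ G) ≠ ∞ :=
      ((measure_mono sdiff_subset).trans_lt hRt.lt_top).ne
    have h := key _ (hR.diff hG) subset_rfl h0 hEt
    have hsum := measure_inter_add_sdiff (μ := weightMeasure w) (rect a b) hG
    rw [inter_eq_self_of_subset_right hGR] at hsum
    rw [← hsum, add_mul, one_mul, add_comm (weightMeasure w G)] at h
    have h2 := (ENNReal.add_le_add_iff_left hEt).1 h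
    calc 2 * weightMeasure w G ≤ 2 * (2⁻¹ * weightMeasure w (rect a b \ G)) := by gcongr
      _ = weightMeasure w (rect a b \ G) := by
          rw [← mul_assoc, ENNReal.mul_inv_cancel (by simp) (by simp), one_mul]
      _ ≤ _ := measure_mono sdiff_subset

/-! ### From rectangles to almost every line -/

/-- The cylinder with base `Q` and fibre `U` in direction `j`. -/
def cylinder (j : Fin (d + 1)) (U : Set ℝ) (Q : Set (Fin d → ℝ)) : Set (Fin (d + 1) → ℝ) :=
  {x | x j ∈ U ∧ j.removeNth x ∈ Q}

lemma measurableSet_cylinder (j : Fin (d + 1)) {U : Set ℝ} (hU : MeasurableSet U)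
    {Q : Set (Fin d → ℝ)} (hQ : MeasurableSet Q) : MeasurableSet (cylinder j U Q) := by
  refine (measurable_pi_apply j hU).inter ?_
  have : Measurable fun x : Fin (d + 1) → ℝ => (j.removeNth x : Fin d → ℝ) :=
    measurable_pi_iff.2 fun i => measurable_pi_apply _
  exact this hQ

lemma section_cylinder (μ : Measure ℝ) (j : Fin (d + 1)) (U : Set ℝ) (Q : Set (Fin d → ℝ))
    (y : Fin d → ℝ) :
    μ {t | (j.insertNth t y : Fin (d + 1) → ℝ) ∈ cylinder j U Q}
      = Q.indicator (fun _ => μ U) y := by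
  by_cases hy : y ∈ Q <;> simp [cylinder, hy]

lemma weightMeasure_cylinder {w : (Fin (d + 1) → ℝ) → ℝ} (hw : IsWeight w) (j : Fin (d + 1))
    {U : Set ℝ} (hU : MeasurableSet U) {Q : Set (Fin d → ℝ)} (hQ : MeasurableSet Q) :
    weightMeasure w (cylinder j U Q) = ∫⁻ y in Q, sectionMeasure w j y U := by
  rw [weightMeasure_eq_lintegral hw j (measurableSet_cylinder j hU hQ), ← lintegral_indicator hQ]
  refine lintegral_congr fun y => (section_cylinder _ _ _ _ _).trans ?_
  by_cases hy : y ∈ Q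
  · rw [indicator_of_mem hy, indicator_of_mem hy]
  · rw [indicator_of_notMem hy, indicator_of_notMem hy]

lemma volume_cylinder (j : Fin (d + 1)) {U : Set ℝ} (hU : MeasurableSet U)
    {Q : Set (Fin d → ℝ)} (hQ : MeasurableSet Q) :
    volume (cylinder j U Q) = volume U * volume Q := by
  rw [volume_eq_lintegral j (measurableSet_cylinder j hU hQ)]
  simp only [section_cylinder]
  rw [lintegral_indicator hQ, setLIntegral_const]

/-- The balls are those of the sup norm, hence cubes. -/
lemma cylinder_ball_eq_rect (j : Fin (d + 1)) (p q : ℝ) (y : Fin d → ℝ) {r : ℝ} (hr : 0 < r) :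
    cylinder j (Ioo p q) (Metric.ball y r)
      = rect (j.insertNth p fun i => y i - r) (j.insertNth q fun i => y i + r) := by
  ext x
  simp only [cylinder, rect, mem_ofPred_eq, ball_pi y hr, mem_univ_pi, Real.ball_eq_Ioo]
  rw [Fin.forall_iff_succAbove j]
  simp [Fin.removeNth]

lemma aemeasurable_sectionMeasure_apply {w : (Fin (d + 1) → ℝ) → ℝ} (hw : IsWeight w)
    (j : Fin (d + 1)) {U : Set ℝ} (hU : MeasurableSet U) :
    AEMeasurable fun y : Fin d → ℝ => sectionMeasure w j y U := by
  have := aemeasurable_sectionMeasure hw j (measurableSet_cylinder j hU MeasurableSet.univ)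
  simpa only [section_cylinder, indicator_univ] using this

/-- Passing from rectangles to lines by differentiation of measures. -/
lemma ae_two_mul_sectionMeasure_le {w : (Fin (d + 1) → ℝ) → ℝ} (hw : IsWeight w) {c : ℝ≥0∞}
    (H : ∀ a b, ∀ G ⊆ rect a b, MeasurableSet G → volume G < c * volume (rect a b) →
      2 * weightMeasure w G ≤ weightMeasure w (rect a b))
    (j : Fin (d + 1)) {p q : ℝ} {U : Set ℝ} (hU : MeasurableSet U) (hUpq : U ⊆ Ioo p q)
    (hUc : volume U < c * volume (Ioo p q)) :
    ∀ᵐ y, 2 * sectionMeasure w j y U ≤ sectionMeasure w j y (Ioo p q) := by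
  set f : (Fin d → ℝ) → ℝ≥0∞ := fun y => 2 * sectionMeasure w j y U with hf
  set g : (Fin d → ℝ) → ℝ≥0∞ := fun y => sectionMeasure w j y (Ioo p q) with hg
  have hfm : AEMeasurable f := (aemeasurable_sectionMeasure_apply hw j hU).const_mul _
  have hball : ∀ y r, 0 < r → ∫⁻ z in Metric.ball y r, f z ≤ ∫⁻ z in Metric.ball y r, g z := by
    intro y r hr
    rw [lintegral_const_mul'' _ (aemeasurable_sectionMeasure_apply hw j hU).restrict,
      ← weightMeasure_cylinder hw j hU measurableSet_ball,
      ← weightMeasure_cylinder hw j measurableSet_Ioo measurableSet_ball,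
      cylinder_ball_eq_rect j p q y hr]
    refine H _ _ _ ?_ (measurableSet_cylinder j hU measurableSet_ball) ?_
    · rw [← cylinder_ball_eq_rect j p q y hr]
      exact fun x hx => ⟨hUpq hx.1, hx.2⟩
    · rw [← cylinder_ball_eq_rect j p q y hr, volume_cylinder j hU measurableSet_ball,
        volume_cylinder j measurableSet_Ioo measurableSet_ball, ← mul_assoc]
      exact ENNReal.mul_lt_mul_left (Metric.measure_ball_pos _ _ hr).ne'
        measure_ball_lt_top.ne hUc
  have hcball : ∀ (h : (Fin d → ℝ) → ℝ≥0∞) y r, 0 < r →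
      volume.withDensity h (Metric.closedBall y r) = ∫⁻ z in Metric.ball y r, h z := by
    intro h y r hr
    rw [withDensity_apply _ measurableSet_closedBall]
    refine setLIntegral_congr (ae_eq_of_subset_of_measure_ge Metric.ball_subset_closedBall ?_
      measurableSet_ball.nullMeasurableSet measure_closedBall_lt_top.ne).symm
    rw [← Metric.ball_union_sphere]
    refine (measure_union_le _ _).trans ?_
    rw [Measure.addHaar_sphere_of_ne_zero volume y hr.ne', add_zero]
  have hgfin : IsLocallyFiniteMeasure (volume.withDensity g) := by
    refine ⟨fun y => ⟨Metric.closedBall y 1, Metric.closedBall_mem_nhds y one_pos, ?_⟩⟩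
    rw [hcball _ _ _ one_pos, ← weightMeasure_cylinder hw j measurableSet_Ioo measurableSet_ball,
      cylinder_ball_eq_rect j p q y one_pos]
    exact (hw.weightMeasure_rect_ne_top _ _).lt_top
  refine ae_le_of_forall_setLIntegral_le_of_sigmaFinite₀ hfm fun s hs _ => ?_
  have key := (Besicovitch.vitaliFamily (volume : Measure (Fin d → ℝ))).measure_le_of_frequently_le
    (volume.withDensity g) (withDensity_absolutelyContinuous volume f) s fun y _ => ?_
  · rwa [withDensity_apply _ hs, withDensity_apply _ hs] at key
  · refine (Besicovitch.tendsto_filterAt volume y).frequently (Filter.Eventually.frequently ?_)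
    filter_upwards [self_mem_nhdsWithin] with r hr
    have hr : 0 < r := hr
    rw [hcball _ _ _ hr, hcball _ _ _ hr]
    exact hball y r hr

/-- Passing from finite unions of rational intervals to open sets. -/
lemma two_mul_measure_le_of_rat {μ : Measure ℝ} (hμ : μ ≪ volume)
    (hfin : ∀ a b, μ (Ioo a b) ≠ ∞) {c : ℝ≥0∞}
    (H : ∀ (s : Finset (ℚ × ℚ)) (p q : ℚ), (⋃ I ∈ s, Ioo (I.1 : ℝ) I.2) ⊆ Ioo (p : ℝ) q →
      volume (⋃ I ∈ s, Ioo (I.1 : ℝ) I.2) < c * volume (Ioo (p : ℝ) q) →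
      2 * μ (⋃ I ∈ s, Ioo (I.1 : ℝ) I.2) ≤ μ (Ioo (p : ℝ) q))
    {a b : ℝ} (hab : a < b) {U : Set ℝ} (hU : IsOpen U) (hUab : U ⊆ Ioo a b)
    (hUc : volume U < c * volume (Ioo a b)) : 2 * μ U ≤ μ (Ioo a b) := by
  classical
  -- `U` is exhausted from inside by finite rational unions, while `(a, b)` is approximated from
  -- outside: a larger interval only weakens the smallness condition.
  have hrat : ∀ p q : ℚ, (p : ℝ) < a → b < q → μ U ≤ μ (Ioo (p : ℝ) q) / 2 := by
    intro p q hp hq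
    have hUeq : U = ⋃ I : {I : ℚ × ℚ // Ioo (I.1 : ℝ) I.2 ⊆ U}, Ioo (I.1.1 : ℝ) I.1.2 := by
      refine subset_antisymm (fun x hx => ?_) (iUnion_subset fun I => I.2)
      obtain ⟨s, t, hst, hsub⟩ := mem_nhds_iff_exists_Ioo_subset.1 (hU.mem_nhds hx)
      obtain ⟨p', hp1, hp2⟩ := exists_rat_btwn hst.1
      obtain ⟨q', hq1, hq2⟩ := exists_rat_btwn hst.2
      exact mem_iUnion.2 ⟨⟨(p', q'), (Ioo_subset_Ioo hp1.le hq2.le).trans hsub⟩, hp2, hq1⟩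
    rw [hUeq]
    refine measure_iUnion_le_of_finset fun s => ?_
    have hs : (⋃ I ∈ s, Ioo ((I : ℚ × ℚ).1 : ℝ) (I : ℚ × ℚ).2)
        = ⋃ I ∈ s.image Subtype.val, Ioo (I.1 : ℝ) I.2 := by
      rw [Finset.set_biUnion_finset_image]
    have hsU : (⋃ I ∈ s, Ioo ((I : ℚ × ℚ).1 : ℝ) (I : ℚ × ℚ).2) ⊆ U :=
      iUnion₂_subset fun I _ => I.2
    have hsub : Ioo a b ⊆ Ioo (p : ℝ) q := Ioo_subset_Ioo hp.le hq.le
    have := H (s.image Subtype.val) p q (hs ▸ hsU.trans (hUab.trans hsub)) (by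
      rw [← hs]
      exact (measure_mono hsU).trans_lt (hUc.trans_le (by gcongr)))
    rw [← hs, mul_comm] at this
    rwa [ENNReal.le_div_iff_mul_le (by simp) (by simp)]
  have : NullSingletonClass μ := ⟨fun x => hμ (measure_singleton x)⟩
  have : IsLocallyFiniteMeasure μ :=
    ⟨fun x => ⟨Ioo (x - 1) (x + 1), Ioo_mem_nhds (by linarith) (by linarith), (hfin _ _).lt_top⟩⟩
  have hlim : Filter.Tendsto (fun r => μ (Metric.cthickening r (Icc a b)))
      (nhdsWithin 0 (Ioi 0)) (nhds (μ (closure (Icc a b)))) :=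
    (tendsto_measure_cthickening ⟨1, one_pos, isCompact_Icc.cthickening.measure_lt_top.ne⟩).mono_left
      nhdsWithin_le_nhds
  rw [isClosed_Icc.closure_eq, ← measure_congr Ioo_ae_eq_Icc] at hlim
  refine ge_of_tendsto hlim ?_
  filter_upwards [self_mem_nhdsWithin] with r hr
  have hr : 0 < r := hr
  obtain ⟨p, hp1, hp2⟩ := exists_rat_btwn (show a - r < a by linarith)
  obtain ⟨q, hq1, hq2⟩ := exists_rat_btwn (show b < b + r by linarith)
  have h := hrat p q hp2 hq1
  rw [ENNReal.le_div_iff_mul_le (by simp) (by simp), mul_comm] at h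
  refine h.trans (measure_mono fun x hx => ?_)
  refine Metric.mem_cthickening_of_dist_le x (max a (min b x)) r _
    ⟨le_max_left _ _, max_le hab.le (min_le_left _ _)⟩ ?_
  rw [Real.dist_eq, abs_le]
  rcases le_total b x with h1 | h1
  · rw [min_eq_left h1, max_eq_right hab.le]
    constructor <;> linarith [hx.2]
  · rw [min_eq_right h1]
    rcases le_total a x with h2 | h2
    · rw [max_eq_right h2]
      constructor <;> linarith
    · rw [max_eq_left h2]
      constructor <;> linarith [hx.1]

/-! ### The quantitative converse -/

/-- The exceptional null set of lines depends on the sets tested, so only the countably many finite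
unions of rational intervals are tested before passing to open sets on a fixed line. -/
lemma strongAInftyConst_le_of_tauberian {w : (Fin (d + 1) → ℝ) → ℝ} (hw : IsWeight w) {δ : ℝ}
    (hδ0 : 0 < δ) (hδ1 : δ < 1) (hT : tauberian w (1 - δ) ≤ 1 + 2⁻¹) {N : ℕ}
    (hN : 2 < δ * 2 ^ N) : strongAInftyConst w ≤ 1 + 4 * N := by
  refine iSup_le fun j => essSup_le_of_ae_le _ ?_
  have hall : ∀ᵐ y : Fin d → ℝ, ∀ (s : Finset (ℚ × ℚ)) (p q : ℚ),
      (⋃ I ∈ s, Ioo (I.1 : ℝ) I.2) ⊆ Ioo (p : ℝ) q →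
      volume (⋃ I ∈ s, Ioo (I.1 : ℝ) I.2) < ENNReal.ofReal δ * volume (Ioo (p : ℝ) q) →
      2 * sectionMeasure w j y (⋃ I ∈ s, Ioo (I.1 : ℝ) I.2)
        ≤ sectionMeasure w j y (Ioo (p : ℝ) q) := by
    simp only [ae_all_iff]
    intro s p q hs hv
    exact ae_two_mul_sectionMeasure_le hw (fun a b G hGR hG hGδ =>
      two_mul_weightMeasure_le hw hδ0 hδ1 hT hG hGR hGδ) j
      (Finset.measurableSet_biUnion _ fun I _ => measurableSet_Ioo) hs hv
  filter_upwards [hall, hw.ae_sectionMeasure_ne_top j] with y hy hfin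
  rw [fujiiWilson_le_iff (by simp) (by finiteness)]
  refine fujiiWilsonLE_of_half hfin fun a b hab U hUab hU hUN => ?_
  refine two_mul_measure_le_of_rat (sectionMeasure_absolutelyContinuous w j y) hfin hy hab hU
    hUab ?_
  have hv0 : volume (Ioo a b) ≠ 0 := by simpa using hab
  have hvt : volume (Ioo a b) ≠ ∞ := by simp
  have h2 : (2 : ℝ≥0∞) < ENNReal.ofReal δ * 2 ^ N := by
    have := (ENNReal.ofReal_lt_ofReal_iff (by positivity)).2 hN
    rwa [ENNReal.ofReal_mul hδ0.le, ENNReal.ofReal_pow (by norm_num), ENNReal.ofReal_ofNat] at this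
  have h3 : 2 ^ N * volume U < 2 ^ N * (ENNReal.ofReal δ * volume (Ioo a b)) := by
    refine hUN.trans_lt ((ENNReal.mul_lt_mul_left hv0 hvt h2).trans_eq ?_)
    ring
  exact lt_of_mul_lt_mul_left' h3

lemma SolyanikEstimate.strongAInftyConst_le {w : (Fin (d + 1) → ℝ) → ℝ} (hw : IsWeight w)
    {B β γ : ℝ} (hB : 1 < B) (hβ : 1 < β) (hγ : 0 < γ) (h : SolyanikEstimate w B β γ) :
    strongAInftyConst w ≤ ENNReal.ofReal (18 * (β * (1 + max (γ / β) (Real.log B)))) := by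
  have hlB : 0 < Real.log B := Real.log_pos hB
  have hl2 : 0 < Real.log 2 := Real.log_pos one_lt_two
  have hβ0 : 0 < β := by linarith
  -- Chosen so that `δ = e^(-L)` lies in the admissible range and `B δ^(1/β) ≤ 1/2`.
  set L := γ + β * (Real.log 2 + Real.log B) with hL
  have hLγ : γ < L := by
    have : 0 < β * (Real.log 2 + Real.log B) := by positivity
    linarith
  have hT : tauberian w (1 - Real.exp (-L)) ≤ 1 + 2⁻¹ := by
    have he : Real.exp (-L) < Real.exp (-γ) := Real.exp_lt_exp.2 (by linarith)
    refine (h (1 - Real.exp (-L)) (by linarith) (by linarith [Real.exp_pos (-L)])).trans ?_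
    gcongr
    rw [show (2⁻¹ : ℝ≥0∞) = ENNReal.ofReal 2⁻¹ by
      rw [ENNReal.ofReal_inv_of_pos (by norm_num), ENNReal.ofReal_ofNat]]
    refine ENNReal.ofReal_le_ofReal ?_
    rw [sub_sub_cancel, ← Real.exp_mul]
    have hexp : Real.exp (-L * (1 / β)) ≤ Real.exp (-(Real.log 2 + Real.log B)) := by
      refine Real.exp_le_exp.2 ?_
      have : -L * (1 / β) = -(γ / β) - (Real.log 2 + Real.log B) := by
        rw [hL]
        field_simp
        ring
      have := div_pos hγ hβ0
      linarith
    rw [← Real.log_mul (by norm_num) (by linarith), Real.exp_neg, Real.exp_log (by linarith)] at hexp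
    calc B * Real.exp (-L * (1 / β)) ≤ B * (2 * B)⁻¹ := by gcongr
      _ = 2⁻¹ := by field_simp
  -- One unit makes `2^(N-1)` exceed `e^L`, the other supplies the factor 2 in `2 < δ 2^N`.
  set N := ⌊L / Real.log 2⌋₊ + 2 with hN
  have hN1 : L / Real.log 2 < (⌊L / Real.log 2⌋₊ : ℝ) + 1 := Nat.lt_floor_add_one _
  have hN2 : (⌊L / Real.log 2⌋₊ : ℝ) ≤ L / Real.log 2 := Nat.floor_le (by positivity)
  have hN3 : 2 < Real.exp (-L) * 2 ^ N := by
    rw [div_lt_iff₀ hl2] at hN1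
    have h1 : Real.exp L < 2 ^ (⌊L / Real.log 2⌋₊ + 1) := by
      rw [← Real.lt_log_iff_exp_lt (by positivity), Real.log_pow]
      push_cast
      exact hN1
    rw [Real.exp_neg, ← div_eq_inv_mul, lt_div_iff₀ (Real.exp_pos L), hN, pow_succ]
    linarith
  refine (strongAInftyConst_le_of_tauberian hw (Real.exp_pos _)
    (Real.exp_lt_one_iff.2 (by linarith)) hT hN3).trans ?_
  have hcast : (1 + 4 * (N : ℝ≥0∞)) = ENNReal.ofReal (1 + 4 * N) := by
    rw [ENNReal.ofReal_add zero_le_one (by positivity), ENNReal.ofReal_one,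
      ENNReal.ofReal_mul (by norm_num), ENNReal.ofReal_ofNat, ENNReal.ofReal_natCast]
  rw [hcast]
  refine ENNReal.ofReal_le_ofReal ?_
  set M := max (γ / β) (Real.log B) with hM
  have hM1 : γ ≤ β * M := by
    have : γ / β ≤ M := le_max_left _ _
    rw [div_le_iff₀ hβ0] at this
    linarith
  have hM2 : β * Real.log B ≤ β * M := by
    gcongr
    exact le_max_right _ _
  have hL2 : L ≤ 2 * (β * M) + 0.7 * β := by
    have : β * Real.log 2 ≤ β * 0.7 := by
      gcongr
      linarith [Real.log_two_lt_d9]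
    rw [hL, mul_add]
    linarith
  have hLlog : L / Real.log 2 ≤ 1.5 * L := by
    rw [div_le_iff₀ hl2]
    nlinarith [Real.log_two_gt_d9]
  have hMpos : 0 < β * M := by linarith
  have hNle : (N : ℝ) ≤ 1.5 * L + 2 := by
    rw [hN]
    push_cast
    linarith
  rw [mul_add]
  linarith

end Solyanik

theorem theorem1 :
    -- weighted Solyanik estimate in dimension `d + 1`, with `c` numerical
    (∃ c : ℝ, 0 < c ∧ ∀ d : ℕ, ∃ K : ℝ, 0 < K ∧
      ∀ w : (Fin (d + 1) → ℝ) → ℝ, Solyanik.StrongAInfty w →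
        Solyanik.SolyanikEstimate w K
          (c * ((d + 1 : ℕ) : ℝ) * (Solyanik.strongAInftyConst w).toReal)
          (c * ((d + 1 : ℕ) : ℝ) * (Solyanik.strongAInftyConst w).toReal)) ∧
    -- optimality
    (∃ c : ℝ, 0 < c ∧ ∀ (d : ℕ) (w : (Fin (d + 1) → ℝ) → ℝ), Solyanik.IsWeight w →
      ∀ B β γ : ℝ, 1 < B → 1 < β → 0 < γ → Solyanik.SolyanikEstimate w B β γ →
        Solyanik.StrongAInfty w ∧
          Solyanik.strongAInftyConst w ≤
            ENNReal.ofReal (c * (β * (1 + max (γ / β) (Real.log B))))) ∧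
    -- characterization
    (∀ (d : ℕ) (w : (Fin (d + 1) → ℝ) → ℝ), Solyanik.IsWeight w →
      (Solyanik.StrongAInfty w ↔
        ∃ B β γ : ℝ, 1 < B ∧ 1 < β ∧ 0 < γ ∧ Solyanik.SolyanikEstimate w B β γ)) := by
  have optimal : ∀ (d : ℕ) (w : (Fin (d + 1) → ℝ) → ℝ), Solyanik.IsWeight w →
      ∀ B β γ : ℝ, 1 < B → 1 < β → 0 < γ → Solyanik.SolyanikEstimate w B β γ →
        Solyanik.StrongAInfty w ∧
          Solyanik.strongAInftyConst w ≤
            ENNReal.ofReal (18 * (β * (1 + max (γ / β) (Real.log B)))) := by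
    intro d w hw B β γ hB hβ hγ h
    have hle := h.strongAInftyConst_le hw hB hβ hγ
    exact ⟨⟨hw, hle.trans_lt ENNReal.ofReal_lt_top⟩, hle⟩
  refine ⟨⟨18, by norm_num, fun d => ⟨17 ^ (d + 1), by positivity,
    fun w hw => hw.solyanikEstimate⟩⟩, ⟨18, by norm_num, optimal⟩, fun d w hw => ⟨fun h => ?_, ?_⟩⟩
  · rcases lt_or_ge (Solyanik.strongAInftyConst w) 1 with h1 | h1
    · refine ⟨2, 2, 1, by norm_num, by norm_num, by norm_num, fun α _ _ => ?_⟩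
      rw [Solyanik.tauberian_eq_zero (hw.weightMeasure_eq_zero h1)]
      exact zero_le
    · have hA1 : 1 ≤ (Solyanik.strongAInftyConst w).toReal := by
        simpa using ENNReal.toReal_mono h.2.ne h1
      have hd : (1 : ℝ) ≤ ((d + 1 : ℕ) : ℝ) := by simp
      have h18 : 1 < 18 * ((d + 1 : ℕ) : ℝ) * (Solyanik.strongAInftyConst w).toReal := by
        nlinarith [mul_le_mul hd hA1 zero_le_one (by linarith)]
      exact ⟨_, _, _, one_lt_pow₀ (by norm_num) (Nat.succ_ne_zero d), h18,
        zero_lt_one.trans h18, h.solyanikEstimate⟩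
  · rintro ⟨B, β, γ, hB, hβ, hγ, h⟩
    exact (optimal d w hw B β γ hB hβ hγ h).1
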